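/- **Theorem 3.18.** Let $K$ be a compact metric space, $M(K)=C(K)^*$ the space of complex Borel measures on $K$ with the total variation norm, and let $A\subseteq C(K)$ be a uniform algebra (a closed subalgebra of the algebra of continuous complex functions that contains the constants and separates the points of $K$). Assume that $A$ is tight: for every $g\in C(K)$ the operator $S_g:A\to C(K)/A$, $f\mapsto fg+A$, is weakly compact. Let $A^\perp=\{\mu\in M(K):\int f\,d\mu=0 \text{ for all } f\in A\}$, and let $\mathcal B=\mathcal B_{A^\perp}$ be the band generated by $A^\perp$, that is, the smallest norm-closed subspace of $M(K)$ which contains $A^\perp$ and contains with every $\mu$ all complex measures $\nu\ll\mu$. Let $L^\infty(\mathcal B)$ be the space of uniformly bounded families $F=\{F_\nu\}_{\nu\in\mathcal B}$ with $F_\nu\in L^\infty(|\nu|)$ and $F_\nu=F_\mu$ $\nu$-a.e. whenever $\nu\ll\mu$, with norm $\|F\|=\sup_\nu\|F_\nu\|_{L^\infty(|\nu|)}$ and the weak-star topology given by the pairing $\langle\nu,F\rangle=\int F_\nu\,d\nu$, $\nu\in\mathcal B$. Let $H^\infty(\mathcal B)$ be the weak-star closure of $A$ in $L^\infty(\mathcal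 B)$ (with $f \in A$ regarded as the family $F_\nu=f$) and, for $m\in\mathcal B$, let $H^\infty(m)$ be the weak-star closure of $A$ in $L^\infty(|m|)=L^1(|m|)^*$. Then there exists a measure $m\in\mathcal B_{A^\perp}$ such that: 1. $m$ is a strong Davie measure for $A$: the natural projection $F\mapsto F_m$ is an isometry of $H^\infty(\mathcal B_{A^\perp})$ onto $H^\infty(m)$; 2. every point $z\in K$ off the Choquet boundary of $A$ has a representing measure absolutely continuous with respect to $|m|$. Here a representing measure for $z$ is a Borel probability measure $\mu$ on $K$ with $\int f\,d\mu=f(z)$ for all $f\in A$, and the Choquet boundary of $A$ is the set of points $z\in K$ whose only representing measure is the point mass $\delta_z$. -/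

import Mathlib

open MeasureTheory
open scoped ENNReal

/-! Throughout, `M(K)` is the space `ComplexMeasure K` of complex Borel measures on a compact metric
space `K` (all of them are regular), `|μ|` is `μ.variation`, and the norm of `M(K)` is
`‖μ‖ = |μ|(K)`. -/

namespace TightAlgebra

section Tight

variable {K : Type*} [TopologicalSpace K] [CompactSpace K]

/-- A uniform algebra on `K`: a closed subalgebra of `C(K)` which contains the constants
(part of `Subalgebra`) and separates the points of `K`. -/
structure IsUniformAlgebra (A : Subalgebra ℂ C(K, ℂ)) : Prop where
  isClosed : IsClosed (A : Set C(K, ℂ))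
  separatesPoints : A.SeparatesPoints

/-- The operator `S_g : X → C(K)/X`, `f ↦ f g + X`. -/
noncomputable def S (X : Submodule ℂ C(K, ℂ)) (g : C(K, ℂ)) : X →L[ℂ] (C(K, ℂ) ⧸ X) :=
  X.mkQL.comp ((ContinuousLinearMap.mul ℂ C(K, ℂ) g).comp X.subtypeL)

/-- A bounded operator is weakly compact if the image of the closed unit ball is relatively compact
in the weak topology of the target. -/
def IsWeaklyCompactOperator {E F : Type*} [SeminormedAddCommGroup E] [NormedSpace ℂ E]
    [SeminormedAddCommGroup F] [NormedSpace ℂ F] (T : E →L[ℂ] F) : Prop :=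
  IsCompact (closure (toWeakSpace ℂ F '' (T '' Metric.closedBall (0 : E) 1)))

/-- `X` is a tight subspace of `C(K)`: a closed subspace such that `S_g` is weakly compact for every
`g ∈ C(K)`. -/
structure IsTight (X : Submodule ℂ C(K, ℂ)) : Prop where
  isClosed : IsClosed (X : Set C(K, ℂ))
  weaklyCompact : ∀ g : C(K, ℂ), IsWeaklyCompactOperator (S X g)

end Tight

section Bands

variable {K : Type*} [MeasurableSpace K]

/-- The integral `∫ f dμ` of a complex function against a complex measure. -/
noncomputable def cintegral (μ : ComplexMeasure K) (f : K → ℂ) : ℂ :=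
  μ.integral f (ContinuousLinearMap.mul ℝ ℂ)

/-- A band of measures: a norm closed subspace of `M(K)` which contains with `μ` every complex
measure absolutely continuous with respect to `μ`. -/
structure IsBand (B : Submodule ℂ (ComplexMeasure K)) : Prop where
  mem_of_approx : ∀ μ : ComplexMeasure K,
    (∀ ε : ℝ≥0∞, 0 < ε → ∃ ν ∈ B, (μ - ν).variation Set.univ < ε) → μ ∈ B
  mem_of_ac : ∀ μ ∈ B, ∀ ν : ComplexMeasure K, ν.variation ≪ μ.variation → ν ∈ B

/-- The band generated by a set of measures: the smallest band that contains it. -/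
noncomputable def bandGenerated (s : Set (ComplexMeasure K)) : Submodule ℂ (ComplexMeasure K) :=
  sInf {B | IsBand B ∧ s ⊆ B}

theorem subset_bandGenerated (s : Set (ComplexMeasure K)) :
    s ⊆ (bandGenerated s : Set (ComplexMeasure K)) := by
  intro μ hμ
  simp only [bandGenerated, SetLike.mem_coe, Submodule.mem_sInf]
  exact fun B hB => hB.2 hμ

theorem isBand_bandGenerated (s : Set (ComplexMeasure K)) : IsBand (bandGenerated s) := by
  constructor
  · intro μ h
    simp only [bandGenerated, Submodule.mem_sInf] at h ⊢
    intro B hB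
    refine hB.1.mem_of_approx μ fun ε hε => ?_
    obtain ⟨ν, hν, hlt⟩ := h ε hε
    exact ⟨ν, hν B hB, hlt⟩
  · intro μ hμ ν hν
    simp only [bandGenerated, Submodule.mem_sInf] at hμ ⊢
    exact fun B hB => hB.1.mem_of_ac μ (hμ B hB) ν hν

/-- `L^∞(B)`: the uniformly bounded families `F = (F_ν)`, indexed by the measures `ν ∈ B`, of
elements `F_ν ∈ L^∞(ν)` such that `F_ν = F_μ` a.e. `[ν]` whenever `ν ≪ μ`. The uniformly bounded
families are the elements of the `ℓ^∞`-product, whose norm is `sup_ν ‖F_ν‖`. -/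
noncomputable def LInfBand (B : Submodule ℂ (ComplexMeasure K)) :
    Submodule ℂ (lp (fun ν : B => Lp ℂ ∞ (ν : ComplexMeasure K).variation) ∞) where
  carrier := {F | ∀ ν μ : B, (ν : ComplexMeasure K).variation ≪ (μ : ComplexMeasure K).variation →
    F ν =ᵐ[(ν : ComplexMeasure K).variation] F μ}
  zero_mem' := by
    intro ν μ h
    have h1 := Lp.coeFn_zero ℂ ∞ (ν : ComplexMeasure K).variation
    have h2 := h.ae_eq (Lp.coeFn_zero ℂ ∞ (μ : ComplexMeasure K).variation)
    exact h1.trans h2.symm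
  add_mem' := by
    intro F G hF hG ν μ h
    have h1 := Lp.coeFn_add (F ν) (G ν)
    have h2 := h.ae_eq (Lp.coeFn_add (F μ) (G μ))
    exact h1.trans (((hF ν μ h).add (hG ν μ h)).trans h2.symm)
  smul_mem' := by
    intro c F hF ν μ h
    have h1 := Lp.coeFn_smul c (F ν)
    have h2 := h.ae_eq (Lp.coeFn_smul c (F μ))
    exact h1.trans (((hF ν μ h).const_smul c).trans h2.symm)

/-- The natural projection `L^∞(B) → L^∞(m)`, `F ↦ F_m`, for `m ∈ B`. -/
noncomputable def proj (B : Submodule ℂ (ComplexMeasure K)) (m : B) :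
    LInfBand B →ₗ[ℂ] Lp ℂ ∞ (m : ComplexMeasure K).variation where
  toFun F := (F : lp (fun ν : B => Lp ℂ ∞ (ν : ComplexMeasure K).variation) ∞) m
  map_add' _ _ := rfl
  map_smul' _ _ := rfl

/-- The weak-star topology of `L^∞(B)`, given by the pairing `⟨ν, F⟩ = ∫ F_ν dν`, `ν ∈ B`. -/
noncomputable abbrev weakStarBand (B : Submodule ℂ (ComplexMeasure K)) : TopologicalSpace (LInfBand B) :=
  TopologicalSpace.induced (fun F (ν : B) => cintegral (ν : ComplexMeasure K) (proj B ν F))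
    Pi.topologicalSpace

/-- The weak-star topology of `L^∞(m) = L^∞(|m|)` as the dual of `L^1(|m|)`. -/
noncomputable abbrev weakStar (m : ComplexMeasure K) : TopologicalSpace (Lp ℂ ∞ m.variation) :=
  TopologicalSpace.induced (fun F (g : Lp ℂ 1 m.variation) => ∫ x, F x * g x ∂m.variation)
    Pi.topologicalSpace

end Bands

section Davie

variable {K : Type*} [MetricSpace K] [CompactSpace K] [MeasurableSpace K] [BorelSpace K]

/-- `X^⊥`: the complex measures which annihilate `X`. -/
def annihilator (X : Submodule ℂ C(K, ℂ)) : Set (ComplexMeasure K) :=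
  {μ | ∀ f ∈ X, cintegral μ f = 0}

/-- `B_{X^⊥}`: the band generated by `X^⊥`. -/
noncomputable def bandPerp (X : Submodule ℂ C(K, ℂ)) : Submodule ℂ (ComplexMeasure K) :=
  bandGenerated (annihilator X)

theorem memLp_top (μ : Measure K) (f : C(K, ℂ)) : MemLp f ∞ μ :=
  memLp_top_of_bound f.continuous.aestronglyMeasurable ‖f‖
    (Filter.Eventually.of_forall fun x => f.norm_coe_le_norm x)

/-- The class of a continuous function in `L^∞(m)`. -/
noncomputable def toLInf (m : ComplexMeasure K) (f : C(K, ℂ)) : Lp ℂ ∞ m.variation :=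
  (memLp_top m.variation f).toLp f

theorem norm_toLInf_le (m : ComplexMeasure K) (f : C(K, ℂ)) : ‖toLInf m f‖ ≤ ‖f‖ := by
  rw [toLInf, Lp.norm_toLp, eLpNorm_exponent_top]
  refine ENNReal.toReal_le_of_le_ofReal (norm_nonneg f) ?_
  exact eLpNormEssSup_le_of_ae_bound (Filter.Eventually.of_forall fun x => f.norm_coe_le_norm x)

/-- A continuous function as the constant family `F_ν = f` in `L^∞(B)`. -/
noncomputable def toLInfBand (B : Submodule ℂ (ComplexMeasure K)) (f : C(K, ℂ)) : LInfBand B :=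
  ⟨⟨fun ν => toLInf (ν : ComplexMeasure K) f,
    memℓp_infty ⟨‖f‖, by rintro _ ⟨ν, rfl⟩; exact norm_toLInf_le _ f⟩⟩, by
    intro ν μ h
    exact ((memLp_top _ f).coeFn_toLp).trans (h.ae_eq ((memLp_top _ f).coeFn_toLp)).symm⟩

/-- `H^∞(B)`: the weak-star closure of `X` in `L^∞(B)`. -/
def HInfBand (X : Submodule ℂ C(K, ℂ)) (B : Submodule ℂ (ComplexMeasure K)) : Set (LInfBand B) :=
  @closure _ (weakStarBand B) (toLInfBand B '' (X : Set C(K, ℂ)))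

/-- `H^∞(m)`: the weak-star closure of `X` in `L^∞(m)`. -/
def HInf (X : Submodule ℂ C(K, ℂ)) (m : ComplexMeasure K) : Set (Lp ℂ ∞ m.variation) :=
  @closure _ (weakStar m) (toLInf m '' (X : Set C(K, ℂ)))

/-- `m ∈ B_{A^⊥}` is a strong Davie measure for `A` if the natural projection `F ↦ F_m` is an
isometry of `H^∞(B_{A^⊥})` onto `H^∞(m)`. -/
structure IsStrongDavieMeasure (A : Subalgebra ℂ C(K, ℂ))
    (m : bandPerp (Subalgebra.toSubmodule A)) : Prop where
  bijOn : Set.BijOn (proj _ m) (HInfBand (Subalgebra.toSubmodule A) (bandPerp _))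
    (HInf (Subalgebra.toSubmodule A) (m : ComplexMeasure K))
  isometry : ∀ F ∈ HInfBand (Subalgebra.toSubmodule A) (bandPerp (Subalgebra.toSubmodule A)),
    ∀ G ∈ HInfBand (Subalgebra.toSubmodule A) (bandPerp (Subalgebra.toSubmodule A)),
      dist (proj _ m F) (proj _ m G) = dist F G

/-- `μ` is a representing measure for `z`: a probability measure with `∫ f dμ = f(z)` on `A`. -/
structure IsRepresenting (A : Subalgebra ℂ C(K, ℂ)) (z : K) (μ : Measure K) : Prop where
  isProbability : IsProbabilityMeasure μ
  integral_eq : ∀ f ∈ A, ∫ x, f x ∂μ = f z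

/-- The Choquet boundary of `A`: the points whose only representing measure is the point mass. -/
def choquetBoundary (A : Subalgebra ℂ C(K, ℂ)) : Set K :=
  {z | ∀ μ : Measure K, IsRepresenting A z μ → μ = Measure.dirac z}

end Davie

end TightAlgebra

set_option linter.unusedSectionVars false

/-! Write X for `A` as a subspace of `C(K)`, and B for the band generated by X^⊥. By Riesz
representation (`toDual`) measures are the functionals on `C(K)`, with the same norm. The heart of
the proof is that B/X^⊥ is norm separable (`isSeparable_bandPerp_mod`).

Since K is metrizable, `C(K)` is separable, so countably many φ_n ∈ X^⊥ cut out X and countably many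
u_k are dense in `C(K)`. Weak compactness of S_g says that for each Φ in the bidual vanishing on X^⊥
there is h ∈ `C(K)` with Φ(gφ) = φ(h) for all φ ∈ X^⊥. If Φ also kills every u_k φ_n, then the h
belonging to g = u_k is killed by every φ_n, so it lies in X, and Φ kills u_k φ for every φ ∈ X^⊥.
By Hahn-Banach the u_k φ_n span, modulo X^⊥ and up to closure, all products gφ
(`exists_countable_span_dense`). By density of continuous functions in L^1 these products generate
the whole band in norm (`bandPerp_le_of_forall_modAct`).

Choose m ∈ B dominating suitable lifts of a countable set that is dense in B/X^⊥. By successive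
approximation every ν ∈ B is congruent modulo X^⊥ to some h|m| with ‖h‖_1 ≤ C‖ν‖, for any C > 1
(`exists_measure_lifting`). Both conclusions follow from this lifting property, called `LiftsBand`.

Strong Davie property: an element F of H^∞(B) annihilates X^⊥, so ⟨ν,F⟩ = ∫ F_m h d|m|, and letting
C tend to 1 gives ‖F‖ ≤ ‖F_m‖. Conversely, for F in H^∞(m) the functional ν ↦ ∫ F h d|m| is well
defined on B, comes from an element of L^∞(B), and lies in H^∞(B) by the bipolar theorem.

Representing measures: if μ ≠ δ_z represents z, then μ - δ_z ∈ A^⊥ has an atom at z, so δ_z ∈ B. Its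
lift h|m| is a complex representing measure, and an L^2 projection turns it into a positive one
(`exists_isRepresenting_of_density`). Only this last passage uses multiplication in `A`. -/

namespace TightAlgebra

/-! ### Complex measures as densities, and their integrals. -/

section Density

variable {K : Type*} [MeasurableSpace K]

/-- A complex measure that vanishes on the null sets of a finite measure has a density. -/
theorem exists_density_of_null (ρ : Measure K) [IsFiniteMeasure ρ] (ν : ComplexMeasure K)
    (H : ∀ s, MeasurableSet s → ρ s = 0 → ν s = 0) :
    ∃ h : K → ℂ, Integrable h ρ ∧ ν = ρ.withDensityᵥ h := by
  have hac : ν ≪ᵥ ρ.toENNRealVectorMeasure := by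
    refine VectorMeasure.AbsolutelyContinuous.mk fun s hs h0 => H s hs ?_
    rwa [Measure.toENNRealVectorMeasure_apply_measurable hs] at h0
  obtain ⟨hre, him⟩ := (ComplexMeasure.absolutelyContinuous_ennreal_iff _ _).1 hac
  have h1 := SignedMeasure.withDensityᵥ_rnDeriv_eq _ ρ hre
  have h2 := SignedMeasure.withDensityᵥ_rnDeriv_eq _ ρ him
  have hi := ComplexMeasure.integrable_rnDeriv ν ρ
  refine ⟨ν.rnDeriv ρ, hi, ?_⟩
  ext s hs
  rw [withDensityᵥ_apply hi hs]
  have e1 : (ν s).re = ∫ x in s, (ComplexMeasure.re ν).rnDeriv ρ x ∂ρ := by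
    rw [← withDensityᵥ_apply (SignedMeasure.integrable_rnDeriv _ _) hs, h1]; rfl
  have e2 : (ν s).im = ∫ x in s, (ComplexMeasure.im ν).rnDeriv ρ x ∂ρ := by
    rw [← withDensityᵥ_apply (SignedMeasure.integrable_rnDeriv _ _) hs, h2]; rfl
  apply Complex.ext
  · rw [e1]
    exact (setIntegral_re_add_im (𝕜 := ℂ) hi.integrableOn ▸ by
      simp [ComplexMeasure.rnDeriv])
  · rw [e2]
    exact (setIntegral_re_add_im (𝕜 := ℂ) hi.integrableOn ▸ by
      simp [ComplexMeasure.rnDeriv])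

/-- The total variations of the real and imaginary parts add up to a finite measure, and `ν` has an
integrable density with respect to it. -/
instance isFiniteMeasure_variation (ν : ComplexMeasure K) : IsFiniteMeasure ν.variation := by
  obtain ⟨h, hi, he⟩ := exists_density_of_null
    ((ComplexMeasure.re ν).totalVariation + (ComplexMeasure.im ν).totalVariation) ν (by
      intro s hs h0
      rw [Measure.add_apply, add_eq_zero] at h0
      have h1 := (SignedMeasure.norm_le_totalVariation (ComplexMeasure.re ν) s)
      have h2 := (SignedMeasure.norm_le_totalVariation (ComplexMeasure.im ν) s)
      rw [measureReal_def, h0.1] at h1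
      rw [measureReal_def, h0.2] at h2
      apply Complex.ext
      · exact norm_le_zero_iff.1 (h1.trans_eq ENNReal.toReal_zero)
      · exact norm_le_zero_iff.1 (h2.trans_eq ENNReal.toReal_zero))
  rw [he, Measure.variation_withDensityᵥ hi]
  exact isFiniteMeasure_withDensity (by simpa using hi.2.ne)

theorem exists_density {ρ : Measure K} [IsFiniteMeasure ρ] {ν : ComplexMeasure K}
    (H : ν.variation ≪ ρ) : ∃ h : K → ℂ, Integrable h ρ ∧ ν = ρ.withDensityᵥ h := by
  refine exists_density_of_null ρ ν fun s hs h0 => ?_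
  have := VectorMeasure.enorm_measure_le_variation ν s
  rw [H h0] at this
  simpa using this

theorem exists_density_self (ν : ComplexMeasure K) :
    ∃ h : K → ℂ, Integrable h ν.variation ∧ ν = ν.variation.withDensityᵥ h :=
  exists_density Measure.AbsolutelyContinuous.rfl

theorem exists_common_density (ν₁ ν₂ : ComplexMeasure K) :
    ∃ (ρ : Measure K) (_ : IsFiniteMeasure ρ) (h₁ h₂ : K → ℂ), Integrable h₁ ρ ∧ Integrable h₂ ρ ∧
      ν₁ = ρ.withDensityᵥ h₁ ∧ ν₂ = ρ.withDensityᵥ h₂ := by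
  obtain ⟨h₁, i₁, e₁⟩ := exists_density (ρ := ν₁.variation + ν₂.variation) (ν := ν₁)
    (Measure.AbsolutelyContinuous.rfl.add_right _)
  obtain ⟨h₂, i₂, e₂⟩ := exists_density (ρ := ν₁.variation + ν₂.variation) (ν := ν₂)
    (by rw [add_comm]; exact Measure.AbsolutelyContinuous.rfl.add_right _)
  exact ⟨_, inferInstance, h₁, h₂, i₁, i₂, e₁, e₂⟩

variable {ρ : Measure K} {h f g : K → ℂ}

theorem variation_withDensityᵥ_ac (hh : Integrable h ρ) : (ρ.withDensityᵥ h).variation ≪ ρ := by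
  rw [Measure.variation_withDensityᵥ hh]
  exact withDensity_absolutelyContinuous _ _

/-- The variation of hρ is |h|ρ, and f|h| and fh differ by a factor of modulus one where h ≠ 0. -/
theorem integrable_variation_withDensityᵥ_iff (hh : Integrable h ρ) :
    Integrable f (ρ.withDensityᵥ h).variation ↔ Integrable (fun x => f x * h x) ρ := by
  rw [Measure.variation_withDensityᵥ hh]
  have := integrable_withDensity_iff_integrable_smul₀ (g := f) (hh.1.nnnorm.aemeasurable)
  refine this.trans ⟨fun H => ?_, fun H => ?_⟩
  · have hb : AEStronglyMeasurable (fun x => h x / (‖h x‖ : ℂ)) ρ :=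
      (hh.1.aemeasurable.div
        (Complex.measurable_ofReal.comp_aemeasurable hh.1.norm.aemeasurable)).aestronglyMeasurable
    refine (H.bdd_mul (c := 1) hb (Filter.Eventually.of_forall fun x => ?_)).congr
      (Filter.Eventually.of_forall fun x => ?_)
    · rw [norm_div]; simpa using div_self_le_one _
    · by_cases h0 : h x = 0
      · simp [h0]
      · have : (‖h x‖ : ℂ) ≠ 0 := by simpa using h0
        simp only [NNReal.smul_def, coe_nnnorm, Complex.real_smul]
        field_simp
  · have hb : AEStronglyMeasurable (fun x => (‖h x‖ : ℂ) / h x) ρ :=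
      ((Complex.measurable_ofReal.comp_aemeasurable hh.1.norm.aemeasurable).div
        hh.1.aemeasurable).aestronglyMeasurable
    refine (H.bdd_mul (c := 1) hb (Filter.Eventually.of_forall fun x => ?_)).congr
      (Filter.Eventually.of_forall fun x => ?_)
    · rw [norm_div]; simpa using div_self_le_one _
    · by_cases h0 : h x = 0
      · simp [h0]
      · simp only [NNReal.smul_def, coe_nnnorm, Complex.real_smul]
        field_simp

theorem integral_norm_variation_withDensityᵥ (hh : Integrable h ρ) :
    ∫ x, ‖f x‖ ∂(ρ.withDensityᵥ h).variation = ∫ x, ‖f x * h x‖ ∂ρ := by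
  rw [Measure.variation_withDensityᵥ hh]
  refine (integral_withDensity_eq_integral_smul₀ (hh.1.nnnorm.aemeasurable) _).trans ?_
  simp [NNReal.smul_def, mul_comm]

theorem ae_mul_eq_of_variation_withDensityᵥ (hh : Integrable h ρ)
    (H : f =ᵐ[(ρ.withDensityᵥ h).variation] g) :
    (fun x => f x * h x) =ᵐ[ρ] fun x => g x * h x := by
  rw [Measure.variation_withDensityᵥ hh] at H
  have := (ae_withDensity_iff' hh.1.enorm).1 H
  filter_upwards [this] with x hx
  by_cases h0 : h x = 0
  · simp [h0]
  · rw [hx (by simpa using h0)]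

/-- Linear extension from indicators; both sides are continuous for the L^1 norm of |hρ|, because
that norm of f equals ∫ |fh| dρ. -/
theorem cintegral_withDensityᵥ (hh : Integrable h ρ)
    (hf : Integrable f (ρ.withDensityᵥ h).variation) :
    cintegral (ρ.withDensityᵥ h) f = ∫ x, f x * h x ∂ρ := by
  refine Integrable.induction
    (fun f => cintegral (ρ.withDensityᵥ h) f = ∫ x, f x * h x ∂ρ) ?_ ?_ ?_ ?_ hf
  · intro c s hs hfin
    rw [cintegral, VectorMeasure.integral_indicator_const c hs]
    · have : (fun x => s.indicator (fun _ => c) x * h x) = s.indicator fun x => c * h x := by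
        ext x; by_cases hx : x ∈ s <;> simp [hx]
      rw [this, integral_indicator hs, integral_const_mul]
      rw [← withDensityᵥ_apply hh hs]; rfl
  · intro f g hd hf hg ihf ihg
    have h1 := VectorMeasure.integral_add (B := ContinuousLinearMap.mul ℝ ℂ) hf hg
    rw [cintegral] at ihf ihg ⊢
    rw [h1, ihf, ihg, ← integral_add]
    · simp [add_mul]
    · exact (integrable_variation_withDensityᵥ_iff hh).1 hf
    · exact (integrable_variation_withDensityᵥ_iff hh).1 hg
  · refine isClosed_eq VectorMeasure.continuous_integral ?_
    refine LipschitzWith.continuous (K := 1) (LipschitzWith.of_dist_le_mul fun f g => ?_)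
    have hf := (integrable_variation_withDensityᵥ_iff hh).1 (L1.integrable_coeFn f)
    have hg := (integrable_variation_withDensityᵥ_iff hh).1 (L1.integrable_coeFn g)
    rw [dist_eq_norm, ← integral_sub hf hg, L1.dist_eq_integral_dist]
    refine (norm_integral_le_integral_norm _).trans ?_
    simp only [dist_eq_norm, ← sub_mul]
    rw [← integral_norm_variation_withDensityᵥ hh]
    simp
  · intro f g hfg hf ih
    rw [cintegral] at ih ⊢
    rw [← VectorMeasure.integral_congr_ae hfg, ih]
    exact integral_congr_ae (ae_mul_eq_of_variation_withDensityᵥ hh hfg)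

theorem variation_univ_withDensityᵥ (hh : Integrable h ρ) :
    ((ρ.withDensityᵥ h).variation Set.univ).toReal = ∫ x, ‖h x‖ ∂ρ := by
  rw [Measure.variation_withDensityᵥ hh, withDensity_apply _ MeasurableSet.univ,
    Measure.restrict_univ, integral_norm_eq_lintegral_enorm hh.1]

theorem variation_withDensityᵥ_one (ρ : Measure K) [IsFiniteMeasure ρ] :
    (ρ.withDensityᵥ (fun _ => (1 : ℂ))).variation = ρ := by
  rw [Measure.variation_withDensityᵥ (integrable_const _)]
  simp

end Density

/-! ### The dual of L^1 of a finite measure is L^∞. -/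

section LInfinity

variable {K : Type*} [MeasurableSpace K]

/-- The hypothesis bounds the variation of Gρ by Cρ, and this variation has density |G|. -/
theorem ae_norm_le_of_setIntegral_le {ρ : Measure K} [IsFiniteMeasure ρ] {G : K → ℂ}
    (hG : Integrable G ρ) {C : ℝ} (hC : 0 ≤ C)
    (H : ∀ s, MeasurableSet s → ‖∫ x in s, G x ∂ρ‖ ≤ C * ρ.real s) : ∀ᵐ x ∂ρ, ‖G x‖ ≤ C := by
  have hv : (ρ.withDensityᵥ G).variation ≤ ENNReal.ofReal C • ρ := by
    refine VectorMeasure.variation_le_of_forall_enorm_le fun s hs => ?_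
    rw [withDensityᵥ_apply hG hs, ← ofReal_norm, Measure.smul_apply, smul_eq_mul,
      ← ENNReal.ofReal_toReal (measure_ne_top ρ s), ← ENNReal.ofReal_mul hC]
    exact ENNReal.ofReal_le_ofReal (H s hs)
  rw [Measure.variation_withDensityᵥ hG] at hv
  have := ae_le_of_forall_setLIntegral_le_of_sigmaFinite₀ (μ := ρ) (f := fun x => ‖G x‖ₑ)
    (g := fun _ => ENNReal.ofReal C) hG.1.enorm (fun s hs _ => by
      rw [← withDensity_apply _ hs]
      simpa using hv s)
  filter_upwards [this] with x hx
  rw [← ofReal_norm] at hx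
  exact (ENNReal.ofReal_le_ofReal_iff hC).1 hx

theorem norm_toLp_top_le {ρ : Measure K} {G : K → ℂ} (hG : MemLp G ∞ ρ) {C : ℝ} (hC : 0 ≤ C)
    (H : ∀ᵐ x ∂ρ, ‖G x‖ ≤ C) : ‖hG.toLp G‖ ≤ C := by
  rw [Lp.norm_toLp, eLpNorm_exponent_top]
  exact ENNReal.toReal_le_of_le_ofReal hC (eLpNormEssSup_le_of_ae_bound H)

theorem norm_Lp_top_le {ρ : Measure K} {G : Lp ℂ ∞ ρ} {C : ℝ} (hC : 0 ≤ C)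
    (H : ∀ᵐ x ∂ρ, ‖G x‖ ≤ C) : ‖G‖ ≤ C := by
  have := norm_toLp_top_le (Lp.memLp G) hC H
  rwa [Lp.toLp_coeFn] at this

theorem ae_norm_le_norm {ρ : Measure K} (G : Lp ℂ ∞ ρ) : ∀ᵐ x ∂ρ, ‖G x‖ ≤ ‖G‖ := by
  have h1 := ae_le_eLpNormEssSup (f := G) (μ := ρ)
  have h2 := (Lp.memLp G).2.ne
  rw [eLpNorm_exponent_top] at h2
  filter_upwards [h1] with x hx
  rw [Lp.norm_def, eLpNorm_exponent_top, ← toReal_enorm (G x)]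
  exact ENNReal.toReal_mono h2 hx

theorem integrable_Lp_top_mul {ρ : Measure K} (G : Lp ℂ ∞ ρ) {k : K → ℂ} (hk : Integrable k ρ) :
    Integrable (fun x => G x * k x) ρ :=
  hk.bdd_mul (Lp.aestronglyMeasurable G) (ae_norm_le_norm G)

theorem norm_integral_Lp_top_mul_le {ρ : Measure K} (G : Lp ℂ ∞ ρ) {k : K → ℂ}
    (hk : Integrable k ρ) : ‖∫ x, G x * k x ∂ρ‖ ≤ ‖G‖ * ∫ x, ‖k x‖ ∂ρ := by
  rw [← integral_const_mul]
  refine norm_integral_le_of_norm_le (hk.norm.const_mul _) ?_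
  filter_upwards [ae_norm_le_norm G] with x hx
  rw [norm_mul]; gcongr

/-- Every bounded functional on `L^1(ρ)` is given by an element of `L^∞(ρ)`. -/
theorem exists_Lp_top_repr {ρ : Measure K} [IsFiniteMeasure ρ] (Ψ : Lp ℂ 1 ρ →L[ℂ] ℂ) :
    ∃ G : Lp ℂ ∞ ρ, ‖G‖ ≤ ‖Ψ‖ ∧ ∀ k : Lp ℂ 1 ρ, Ψ k = ∫ x, G x * k x ∂ρ := by
  classical
  let e : Set K → Lp ℂ 1 ρ := fun s =>
    if hs : MeasurableSet s then indicatorConstLp 1 hs (measure_ne_top ρ s) 1 else 0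
  have e_def : ∀ {s} (hs : MeasurableSet s),
      e s = indicatorConstLp 1 hs (measure_ne_top ρ s) 1 := fun hs => dif_pos hs
  have e_norm : ∀ {s} (hs : MeasurableSet s), ‖e s‖ = ρ.real s := fun {s} hs => by
    rw [e_def hs, norm_indicatorConstLp one_ne_zero ENNReal.one_ne_top]; simp
  have e_union : ∀ {s t}, MeasurableSet s → MeasurableSet t → Disjoint s t →
      e (s ∪ t) = e s + e t := fun {s t} hs ht hd => by
    rw [e_def hs, e_def ht, e_def (hs.union ht)]
    exact indicatorConstLp_disjoint_union hs ht _ _ hd 1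
  -- The set function s ↦ Ψ(1_s) is a complex measure; its Radon-Nikodym density is the required
  -- element of L^∞.
  let ν : ComplexMeasure K :=
    { measureOf' := fun s => Ψ (e s)
      empty' := by
        have : e ∅ = 0 := by rw [← norm_eq_zero, e_norm MeasurableSet.empty]; simp
        simp [this]
      not_measurable' := fun s hs => by simp [e, hs]
      m_iUnion' := fun f hf hd => by
        refine ContinuousLinearMap.hasSum Ψ (f := fun i => e (f i)) ?_
        have hsum : Summable fun i => ‖e (f i)‖ := by
          simp only [e_norm (hf _), measureReal_def]
          refine ENNReal.summable_toReal ?_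
          rw [← measure_iUnion hd hf]
          exact measure_ne_top _ _
        refine (hasSum_iff_tendsto_nat_of_summable_norm hsum).2 ?_
        have hpart : ∀ n, ∑ i ∈ Finset.range n, e (f i) = e (⋃ i ∈ Finset.range n, f i) := by
          intro n
          induction n with
          | zero =>
            have : e ∅ = 0 := by rw [← norm_eq_zero, e_norm MeasurableSet.empty]; simp
            simp [this]
          | succ n ih =>
            rw [Finset.sum_range_succ, ih, Finset.range_add_one, Finset.set_biUnion_insert,
              Set.union_comm, e_union (Finset.measurableSet_biUnion _ fun i _ => hf i) (hf n)]
            simp only [Finset.mem_range, Set.disjoint_iUnion_left]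
            exact fun i hi => hd (ne_of_lt hi)
        simp only [hpart]
        rw [tendsto_iff_norm_sub_tendsto_zero]
        have hdiff : ∀ n, ‖e (⋃ i ∈ Finset.range n, f i) - e (⋃ i, f i)‖
            = ρ.real (⋃ i, f i) - ρ.real (⋃ i ∈ Finset.range n, f i) := by
          intro n
          have hm := Finset.measurableSet_biUnion (Finset.range n) fun i _ => hf i
          have hsub : (⋃ i ∈ Finset.range n, f i) ⊆ ⋃ i, f i :=
            Set.iUnion₂_subset fun i _ => Set.subset_iUnion f i
          have hU := MeasurableSet.iUnion hf
          have : e (⋃ i, f i) = e (⋃ i ∈ Finset.range n, f i)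
              + e ((⋃ i, f i) \ ⋃ i ∈ Finset.range n, f i) := by
            rw [← e_union hm (hU.diff hm) Set.disjoint_sdiff_right, Set.union_sdiff_cancel hsub]
          rw [this, ← norm_neg, neg_sub, add_sub_cancel_left, e_norm (hU.diff hm),
            measureReal_sdiff hsub hm]
        simp only [hdiff]
        have hlim : Filter.Tendsto (fun n => ∑ i ∈ Finset.range n, ρ.real (f i)) Filter.atTop
            (nhds (ρ.real (⋃ i, f i))) := by
          have : HasSum (fun i => ρ.real (f i)) (ρ.real (⋃ i, f i)) := by
            have hs : Summable fun i => ρ.real (f i) := by simpa only [e_norm (hf _)] using hsum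
            convert hs.hasSum
            rw [measureReal_def, measure_iUnion hd hf, ENNReal.tsum_toReal_eq]
            · rfl
            · exact fun i => measure_ne_top _ _
          exact this.tendsto_sum_nat
        have hfin : ∀ n, ρ.real (⋃ i ∈ Finset.range n, f i)
            = ∑ i ∈ Finset.range n, ρ.real (f i) := fun n =>
          measureReal_biUnion_finset (fun i _ j _ hij => hd hij) fun i _ => hf i
        simp only [hfin]
        simpa using hlim.const_sub (ρ.real (⋃ i, f i)) }
  have hν : ∀ s, ν s = Ψ (e s) := fun s => rfl
  obtain ⟨g, hg, hνg⟩ := exists_density_of_null ρ ν fun s hs h0 => by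
    have : e s = 0 := by rw [← norm_eq_zero, e_norm hs, measureReal_def, h0]; rfl
    rw [hν, this, map_zero]
  have hgs : ∀ s, MeasurableSet s → ∫ x in s, g x ∂ρ = Ψ (e s) := fun s hs => by
    rw [← withDensityᵥ_apply hg hs, ← hνg, hν]
  have hbd : ∀ᵐ x ∂ρ, ‖g x‖ ≤ ‖Ψ‖ := by
    refine ae_norm_le_of_setIntegral_le hg (norm_nonneg _) fun s hs => ?_
    rw [hgs s hs, ← e_norm hs]
    exact Ψ.le_opNorm _
  have hG : MemLp g ∞ ρ := memLp_top_of_bound hg.1 _ hbd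
  refine ⟨hG.toLp g, norm_toLp_top_le hG (norm_nonneg _) hbd, fun k => ?_⟩
  have hae := hG.coeFn_toLp
  induction k using Lp.induction ENNReal.one_ne_top with
  | indicatorConst c hs hfin =>
    rename_i s
    have h1 : (Lp.simpleFunc.indicatorConst 1 hs hfin.ne c : Lp ℂ 1 ρ) = c • e s := by
      rw [Lp.simpleFunc.coe_indicatorConst, e_def hs]
      refine Lp.ext ?_
      filter_upwards [indicatorConstLp_coeFn (p := 1) (hs := hs) (hμs := hfin.ne) (c := c),
        Lp.coeFn_smul c (indicatorConstLp 1 hs (measure_ne_top ρ s) (1 : ℂ)),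
        indicatorConstLp_coeFn (p := 1) (hs := hs) (hμs := hfin.ne) (c := (1 : ℂ))]
        with x h1 h2 h3
      rw [h1, h2, Pi.smul_apply, h3]
      by_cases hx : x ∈ s <;> simp [hx]
    rw [h1, map_smul, ← hgs s hs]
    have h2 : (fun x => (hG.toLp g) x * (c • e s : Lp ℂ 1 ρ) x)
        =ᵐ[ρ] s.indicator fun x => c * g x := by
      have h3 := indicatorConstLp_coeFn (p := 1) (hs := hs) (hμs := measure_ne_top ρ s)
        (c := (1 : ℂ))
      rw [← e_def hs] at h3
      filter_upwards [hae, h3, Lp.coeFn_smul c (e s)] with x hx1 hx2 hx3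
      rw [hx1, hx3, Pi.smul_apply, hx2]
      by_cases hx : x ∈ s <;> simp [hx, mul_comm]
    rw [integral_congr_ae h2, integral_indicator hs, integral_const_mul, smul_eq_mul]
  | add hf' hg' hd ihf ihg =>
    rw [map_add, ihf, ihg, ← integral_add (integrable_Lp_top_mul _ (L1.integrable_coeFn _))
      (integrable_Lp_top_mul _ (L1.integrable_coeFn _))]
    refine integral_congr_ae ?_
    filter_upwards [Lp.coeFn_add (hf'.toLp _) (hg'.toLp _)] with x hx
    rw [hx, Pi.add_apply, mul_add]
  | isClosed =>
    refine isClosed_eq Ψ.continuous ?_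
    refine LipschitzWith.continuous (K := ‖hG.toLp g‖₊) (LipschitzWith.of_dist_le_mul fun f g => ?_)
    rw [dist_eq_norm, ← integral_sub (integrable_Lp_top_mul _ (L1.integrable_coeFn _))
      (integrable_Lp_top_mul _ (L1.integrable_coeFn _)), L1.dist_eq_integral_dist]
    simp only [← mul_sub, dist_eq_norm]
    exact norm_integral_Lp_top_mul_le _ ((L1.integrable_coeFn f).sub (L1.integrable_coeFn g))

end LInfinity

/-! ### The absolute value of a functional on `C(K)` is additive. -/

section Modulus

open scoped NNReal

variable {K : Type*} [TopologicalSpace K] (φ : StrongDual ℂ C(K, ℂ))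

/-- The value of the total variation `|φ|` of a functional at a nonnegative function. -/
noncomputable def modulus (f : K → ℝ≥0) : ℝ≥0 :=
  sSup {r | ∃ g : C(K, ℂ), (∀ x, ‖g x‖₊ ≤ f x) ∧ r = ‖φ g‖₊}

variable {φ} {f : K → ℝ≥0}

theorem modulus_nonempty (φ : StrongDual ℂ C(K, ℂ)) (f : K → ℝ≥0) :
    {r | ∃ g : C(K, ℂ), (∀ x, ‖g x‖₊ ≤ f x) ∧ r = ‖φ g‖₊}.Nonempty :=
  ⟨0, 0, by simp⟩

theorem modulus_le {c : ℝ≥0} (H : ∀ g : C(K, ℂ), (∀ x, ‖g x‖₊ ≤ f x) → ‖φ g‖₊ ≤ c) :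
    modulus φ f ≤ c := by
  refine csSup_le (modulus_nonempty φ f) ?_
  rintro _ ⟨g, hg, rfl⟩
  exact H g hg

variable [CompactSpace K]

theorem le_modulus (hf : Continuous f) {g : C(K, ℂ)} (hg : ∀ x, ‖g x‖₊ ≤ f x) :
    ‖φ g‖₊ ≤ modulus φ f := by
  refine le_csSup ?_ ⟨g, hg, rfl⟩
  obtain ⟨C, hC⟩ := (isCompact_range hf).bddAbove
  refine ⟨‖φ‖₊ * C, ?_⟩
  rintro _ ⟨g, hg, rfl⟩
  refine (φ.le_opNNNorm g).trans ?_
  gcongr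
  exact (ContinuousMap.norm_le _ C.2).2 fun x => (hg x).trans (hC ⟨x, rfl⟩)

theorem mul_modulus_le (hf : Continuous f) (c : ℝ≥0) :
    c * modulus φ f ≤ modulus φ (fun x => c * f x) := by
  rcases eq_or_ne c 0 with rfl | hc
  · simp
  rw [mul_comm, ← le_div_iff₀ (pos_iff_ne_zero.2 hc)]
  refine modulus_le fun g hg => ?_
  rw [le_div_iff₀ (pos_iff_ne_zero.2 hc), mul_comm]
  have : c * ‖φ g‖₊ = ‖φ ((c : ℂ) • g)‖₊ := by
    rw [map_smul, nnnorm_smul]; congr 1; ext; simp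
  rw [this]
  refine le_modulus (by fun_prop) fun x => ?_
  have : ‖((c : ℂ) • g) x‖₊ = c * ‖g x‖₊ := by
    rw [ContinuousMap.smul_apply, nnnorm_smul]; congr 1; ext; simp
  rw [this]
  gcongr
  exact hg x

theorem modulus_const_mul (hf : Continuous f) (c : ℝ≥0) :
    modulus φ (fun x => c * f x) = c * modulus φ f := by
  refine le_antisymm ?_ (mul_modulus_le hf c)
  rcases eq_or_ne c 0 with rfl | hc
  · refine modulus_le fun g hg => ?_
    have : g = 0 := by ext x; simpa using hg x
    simp [this]
  · have := mul_modulus_le (φ := φ) (f := fun x => c * f x) (by fun_prop) c⁻¹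
    simp only [inv_mul_cancel_left₀ hc] at this
    rwa [inv_mul_le_iff₀ (pos_iff_ne_zero.2 hc)] at this

/-- For ≤, a function g bounded by f₁ + f₂ is split in the proportion f₁ : f₂. For ≥, test functions
for f₁ and f₂ are rotated so that their values under φ add without cancellation. -/
theorem modulus_add {f₁ f₂ : K → ℝ≥0} (h₁ : Continuous f₁) (h₂ : Continuous f₂) :
    modulus φ (fun x => f₁ x + f₂ x) = modulus φ f₁ + modulus φ f₂ := by
  apply le_antisymm
  · refine modulus_le fun g hg => ?_
    refine le_of_forall_pos_le_add fun ε hε => ?_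
    obtain ⟨δ, hδ, hδε⟩ : ∃ δ : ℝ≥0, 0 < δ ∧ ‖φ‖₊ * δ ≤ ε := by
      refine ⟨ε / (‖φ‖₊ + 1), by positivity, ?_⟩
      rw [mul_div_assoc', div_le_iff₀ (by positivity), mul_comm]
      gcongr
      simp
    -- The padding δ keeps the denominator positive where f₁ + f₂ vanishes; it produces a third
    -- piece of g, on which φ is at most ε.
    let d : K → ℝ≥0 := fun x => f₁ x + f₂ x + δ
    have hd : ∀ x, d x ≠ 0 := fun x => (add_pos_of_nonneg_of_pos zero_le hδ).ne'
    have hdc : Continuous d := by fun_prop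
    have key : ∀ k : K → ℝ≥0, Continuous k → ∃ g' : C(K, ℂ),
        ∀ x, g' x = g x * ((k x / d x : ℝ≥0) : ℂ) := fun k hk => by
      have hq : Continuous fun x => k x / d x := hk.div₀ hdc hd
      exact ⟨⟨fun x => g x * ((k x / d x : ℝ≥0) : ℂ), g.continuous.mul
        (Complex.continuous_ofReal.comp (NNReal.continuous_coe.comp hq))⟩, fun x => rfl⟩
    obtain ⟨g₁, hg₁⟩ := key f₁ h₁
    obtain ⟨g₂, hg₂⟩ := key f₂ h₂
    obtain ⟨g₃, hg₃⟩ := key (fun _ => δ) continuous_const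
    have hsum : g = g₁ + g₂ + g₃ := by
      ext x
      have : ((f₁ x / d x + f₂ x / d x + δ / d x : ℝ≥0) : ℂ) = 1 := by
        rw [← add_div, ← add_div, div_self (hd x)]; simp
      push_cast at this
      simp only [ContinuousMap.add_apply, hg₁, hg₂, hg₃]
      push_cast
      rw [← mul_add, ← mul_add, this, mul_one]
    have hnn : ∀ (k : K → ℝ≥0) (x : K), ‖g x * ((k x / d x : ℝ≥0) : ℂ)‖₊ ≤ k x := fun k x => by
      have e : ‖((k x / d x : ℝ≥0) : ℂ)‖₊ = k x / d x := by ext; simp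
      rw [nnnorm_mul, e, mul_div_assoc', div_le_iff₀ (pos_iff_ne_zero.2 (hd x)), mul_comm]
      gcongr
      exact (hg x).trans (le_self_add)
    have b₁ := le_modulus (φ := φ) h₁ (g := g₁) fun x => by rw [hg₁]; exact hnn f₁ x
    have b₂ := le_modulus (φ := φ) h₂ (g := g₂) fun x => by rw [hg₂]; exact hnn f₂ x
    have b₃ : ‖φ g₃‖₊ ≤ ε := by
      refine (φ.le_opNNNorm _).trans (le_trans ?_ hδε)
      gcongr
      exact (ContinuousMap.norm_le _ δ.2).2 fun x => by rw [hg₃]; exact hnn (fun _ => δ) x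
    calc ‖φ g‖₊ = ‖φ g₁ + φ g₂ + φ g₃‖₊ := by rw [hsum, map_add, map_add]
      _ ≤ ‖φ g₁‖₊ + ‖φ g₂‖₊ + ‖φ g₃‖₊ := norm_add₃_le
      _ ≤ _ := by gcongr
  · have hrot : ∀ z : ℂ, ∃ c : ℂ, ‖c‖₊ ≤ 1 ∧ c * z = (‖z‖ : ℂ) := fun z => by
      by_cases hz : z = 0
      · exact ⟨0, by simp, by simp [hz]⟩
      · refine ⟨‖z‖ / z, ?_, by field_simp⟩
        rw [← NNReal.coe_le_coe]
        simp [hz]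
    have step : ∀ g₁ : C(K, ℂ), (∀ x, ‖g₁ x‖₊ ≤ f₁ x) → ∀ g₂ : C(K, ℂ),
        (∀ x, ‖g₂ x‖₊ ≤ f₂ x) → ‖φ g₁‖₊ + ‖φ g₂‖₊ ≤ modulus φ (fun x => f₁ x + f₂ x) := by
      intro g₁ hg₁ g₂ hg₂
      obtain ⟨c₁, hc₁, e₁⟩ := hrot (φ g₁)
      obtain ⟨c₂, hc₂, e₂⟩ := hrot (φ g₂)
      have e : ‖φ g₁‖₊ + ‖φ g₂‖₊ = ‖φ (c₁ • g₁ + c₂ • g₂)‖₊ := by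
        rw [map_add, map_smul, map_smul, smul_eq_mul, smul_eq_mul, e₁, e₂, ← Complex.ofReal_add]
        ext
        simp only [NNReal.coe_add, coe_nnnorm, Complex.norm_real, Real.norm_eq_abs]
        rw [abs_of_nonneg (by positivity)]
      rw [e]
      refine le_modulus (by fun_prop) fun x => ?_
      refine (nnnorm_add_le _ _).trans (add_le_add ?_ ?_)
      · rw [ContinuousMap.smul_apply, nnnorm_smul]
        exact (mul_le_of_le_one_left zero_le hc₁).trans (hg₁ x)
      · rw [ContinuousMap.smul_apply, nnnorm_smul]
        exact (mul_le_of_le_one_left zero_le hc₂).trans (hg₂ x)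
    have s₁ : ∀ g₁ : C(K, ℂ), (∀ x, ‖g₁ x‖₊ ≤ f₁ x) →
        ‖φ g₁‖₊ + modulus φ f₂ ≤ modulus φ (fun x => f₁ x + f₂ x) := fun g₁ hg₁ => by
      have hle : ‖φ g₁‖₊ ≤ modulus φ (fun x => f₁ x + f₂ x) :=
        le_self_add.trans (step g₁ hg₁ 0 (by simp))
      rw [add_comm, ← le_tsub_iff_right hle]
      exact modulus_le fun g₂ hg₂ => le_tsub_of_add_le_left (step g₁ hg₁ g₂ hg₂)
    have hle : modulus φ f₂ ≤ modulus φ (fun x => f₁ x + f₂ x) :=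
      le_add_self.trans (s₁ 0 (by simp))
    rw [← le_tsub_iff_right hle]
    exact modulus_le fun g₁ hg₁ => le_tsub_of_add_le_right (s₁ g₁ hg₁)

end Modulus

/-! ### Riesz representation of complex functionals. -/

section Riesz

open scoped NNReal

variable {K : Type*} [MetricSpace K] [CompactSpace K] [MeasurableSpace K] [BorelSpace K]

/-- Every bounded functional on `C(K)` is dominated by the integral of a finite measure. -/
theorem exists_dominating_measure (φ : StrongDual ℂ C(K, ℂ)) :
    ∃ ρ : Measure K, IsFiniteMeasure ρ ∧ ∀ g : C(K, ℂ), ‖φ g‖ ≤ ∫ x, ‖g x‖ ∂ρ := by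
  let Λ : CompactlySupportedContinuousMap K ℝ≥0 →ₗ[ℝ≥0] ℝ≥0 :=
    { toFun := fun f => modulus φ f
      map_add' := fun f g => modulus_add f.continuous g.continuous
      map_smul' := fun c f => modulus_const_mul f.continuous c }
  refine ⟨NNRealRMK.rieszMeasure Λ, inferInstance, fun g => ?_⟩
  let n : CompactlySupportedContinuousMap K ℝ≥0 :=
    ⟨⟨fun x => ‖g x‖₊, by fun_prop⟩, HasCompactSupport.of_compactSpace _⟩
  have h1 := NNRealRMK.integral_rieszMeasure Λ n
  have h2 : ‖φ g‖₊ ≤ modulus φ n := le_modulus n.continuous fun x => le_rfl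
  exact (NNReal.coe_le_coe.2 h2).trans_eq h1.symm

theorem integrable_continuousMap (ρ : Measure K) [IsFiniteMeasure ρ] (f : C(K, ℂ)) :
    Integrable f ρ :=
  (memLp_top ρ f).integrable le_top

/-- The Riesz representation of the functionals on `C(K)` by measures with a density. -/
theorem exists_density_eq_functional (φ : StrongDual ℂ C(K, ℂ)) :
    ∃ (ρ : Measure K) (_ : IsFiniteMeasure ρ) (h : K → ℂ), Integrable h ρ ∧
      ∀ g : C(K, ℂ), φ g = ∫ x, g x * h x ∂ρ := by
  obtain ⟨ρ, hρ, hφ⟩ := exists_dominating_measure φ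
  -- Domination by ρ makes φ continuous for the L^1(ρ) norm, so it extends from the dense image of
  -- `C(K)` to L^1(ρ) and L^1-L^∞ duality applies.
  have hd := ContinuousMap.toLp_denseRange (α := K) ℂ ρ ℂ ENNReal.one_ne_top
  have hcoe : ∀ g : C(K, ℂ), ContinuousMap.toLp 1 ρ ℂ g =ᵐ[ρ] g := fun g =>
    ContinuousMap.coeFn_toLp ρ g
  have hn : ∀ g : C(K, ℂ), ‖φ g‖ ≤ 1 * ‖ContinuousMap.toLp 1 ρ ℂ g‖ := fun g => by
    rw [one_mul, L1.norm_eq_integral_norm]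
    refine (hφ g).trans_eq (integral_congr_ae ?_)
    filter_upwards [hcoe g] with x hx
    rw [hx]
  let Ψ := φ.toLinearMap.extendOfNorm (ContinuousMap.toLp 1 ρ ℂ).toLinearMap
  obtain ⟨G, -, hG⟩ := exists_Lp_top_repr Ψ
  refine ⟨ρ, hρ, G, (Lp.memLp G).integrable le_top, fun g => ?_⟩
  have : Ψ (ContinuousMap.toLp 1 ρ ℂ g) = φ g :=
    LinearMap.extendOfNorm_eq (f := φ.toLinearMap)
      (e := (ContinuousMap.toLp 1 ρ ℂ).toLinearMap) hd ⟨1, hn⟩ g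
  rw [← this, hG]
  refine integral_congr_ae ?_
  filter_upwards [hcoe g] with x hx
  rw [hx, mul_comm]

end Riesz

/-! ### `M(K)` as the dual of `C(K)`, with multiplication by continuous functions. -/

section ModuleAction

variable {K : Type*} [TopologicalSpace K] [CompactSpace K]

/-- The functional `f ↦ φ (g f)`. -/
noncomputable def modAct (g : C(K, ℂ)) (φ : StrongDual ℂ C(K, ℂ)) : StrongDual ℂ C(K, ℂ) :=
  φ.comp (ContinuousLinearMap.mul ℂ C(K, ℂ) g)

end ModuleAction

section DualSpace

variable {K : Type*} [MetricSpace K] [CompactSpace K] [MeasurableSpace K] [BorelSpace K]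

theorem cintegral_withDensityᵥ_continuousMap {ρ : Measure K} {h : K → ℂ} (hh : Integrable h ρ)
    (f : C(K, ℂ)) : cintegral (ρ.withDensityᵥ h) f = ∫ x, f x * h x ∂ρ :=
  cintegral_withDensityᵥ hh (integrable_continuousMap _ f)

theorem integrable_continuousMap_mul {ρ : Measure K} {h : K → ℂ} (hh : Integrable h ρ)
    (f : C(K, ℂ)) : Integrable (fun x => f x * h x) ρ :=
  hh.bdd_mul f.continuous.aestronglyMeasurable
    (Filter.Eventually.of_forall fun x => f.norm_coe_le_norm x)

theorem norm_integral_continuousMap_mul_le {ρ : Measure K} {h : K → ℂ} (hh : Integrable h ρ)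
    (f : C(K, ℂ)) : ‖∫ x, f x * h x ∂ρ‖ ≤ ‖f‖ * ∫ x, ‖h x‖ ∂ρ := by
  rw [← integral_const_mul]
  refine norm_integral_le_of_norm_le (hh.norm.const_mul _) (Filter.Eventually.of_forall fun x => ?_)
  rw [norm_mul]
  gcongr
  exact f.norm_coe_le_norm x

theorem norm_cintegral_le (ν : ComplexMeasure K) (f : C(K, ℂ)) :
    ‖cintegral ν f‖ ≤ (ν.variation Set.univ).toReal * ‖f‖ := by
  obtain ⟨ρ, _, h, -, hi, -, rfl, -⟩ := exists_common_density ν ν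
  rw [variation_univ_withDensityᵥ hi, cintegral_withDensityᵥ_continuousMap hi, mul_comm]
  exact norm_integral_continuousMap_mul_le hi f

/-- A complex measure as a functional on `C(K)`. -/
noncomputable def toDual : ComplexMeasure K →ₗ[ℂ] StrongDual ℂ C(K, ℂ) where
  toFun ν := LinearMap.mkContinuous
    { toFun := fun f => cintegral ν f
      map_add' := fun f g => by
        obtain ⟨h, hi, he⟩ := exists_density_self ν
        rw [he]
        simp only [cintegral_withDensityᵥ_continuousMap hi]
        rw [← integral_add (integrable_continuousMap_mul hi f) (integrable_continuousMap_mul hi g)]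
        simp [add_mul]
      map_smul' := fun c f => by
        obtain ⟨h, hi, he⟩ := exists_density_self ν
        rw [he]
        simp only [cintegral_withDensityᵥ_continuousMap hi]
        rw [RingHom.id_apply, smul_eq_mul, ← integral_const_mul]
        simp [mul_assoc] }
    (ν.variation Set.univ).toReal (norm_cintegral_le ν)
  map_add' ν₁ ν₂ := by
    obtain ⟨ρ, _, h₁, h₂, i₁, i₂, rfl, rfl⟩ := exists_common_density ν₁ ν₂
    ext f
    simp only [LinearMap.mkContinuous_apply, LinearMap.coe_mk, AddHom.coe_mk,
      add_apply]
    rw [← withDensityᵥ_add i₁ i₂]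
    simp only [cintegral_withDensityᵥ_continuousMap i₁, cintegral_withDensityᵥ_continuousMap i₂,
      cintegral_withDensityᵥ_continuousMap (i₁.add i₂)]
    rw [← integral_add (integrable_continuousMap_mul i₁ f) (integrable_continuousMap_mul i₂ f)]
    simp [mul_add]
  map_smul' c ν := by
    obtain ⟨ρ, _, h, -, hi, -, rfl, -⟩ := exists_common_density ν ν
    ext f
    simp only [LinearMap.mkContinuous_apply, LinearMap.coe_mk, AddHom.coe_mk,
      smul_apply, RingHom.id_apply]
    rw [← withDensityᵥ_smul]
    simp only [cintegral_withDensityᵥ_continuousMap hi,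
      cintegral_withDensityᵥ_continuousMap (hi.smul c)]
    rw [smul_eq_mul, ← integral_const_mul]
    simp [mul_left_comm]

theorem toDual_withDensityᵥ {ρ : Measure K} {h : K → ℂ} (hh : Integrable h ρ) (f : C(K, ℂ)) :
    toDual (ρ.withDensityᵥ h) f = ∫ x, f x * h x ∂ρ :=
  cintegral_withDensityᵥ_continuousMap hh f

theorem exists_continuousMap_norm_le_one {ρ : Measure K} [IsFiniteMeasure ρ] {s : K → ℂ}
    (hs : Integrable s ρ) (h1 : ∀ x, ‖s x‖ ≤ 1) {ε : ℝ} (hε : 0 < ε) :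
    ∃ f : C(K, ℂ), ‖f‖ ≤ 1 ∧ ∫ x, ‖s x - f x‖ ∂ρ ≤ ε := by
  obtain ⟨g, hg, hgi⟩ := hs.exists_boundedContinuous_integral_sub_le (half_pos hε)
  have hpos : ∀ x, (max 1 ‖g x‖ : ℝ) ≠ 0 := fun x => (lt_max_of_lt_left one_pos).ne'
  let f : C(K, ℂ) := ⟨fun x => ((max 1 ‖g x‖ : ℝ)⁻¹ : ℝ) • g x, by
    have := g.continuous
    exact ((continuous_const.max this.norm).inv₀ hpos).smul this⟩
  refine ⟨f, (ContinuousMap.norm_le _ zero_le_one).2 fun x => ?_, ?_⟩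
  · change ‖((max 1 ‖g x‖ : ℝ)⁻¹ : ℝ) • g x‖ ≤ 1
    rw [norm_smul, norm_inv, Real.norm_of_nonneg (by positivity), inv_mul_le_iff₀ (by positivity)]
    simp
  -- Retracting g to the unit disc moves it by |g| - 1 where |g| ≥ 1, and this is at most |s - g|
  -- since |s| ≤ 1; hence the factor 2 and the choice of ε/2 above.
  · have hle : ∀ x, ‖s x - f x‖ ≤ 2 * ‖s x - g x‖ := fun x => by
      change ‖s x - ((max 1 ‖g x‖ : ℝ)⁻¹ : ℝ) • g x‖ ≤ _
      rcases le_total ‖g x‖ 1 with h | h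
      · rw [max_eq_left h]
        simp only [inv_one, one_smul]
        linarith [norm_nonneg (s x - g x)]
      · rw [max_eq_right h]
        have hg0 : ‖g x‖ ≠ 0 := (one_pos.trans_le h).ne'
        have e : ‖g x - (‖g x‖⁻¹ : ℝ) • g x‖ = ‖g x‖ - 1 := by
          have : g x - (‖g x‖⁻¹ : ℝ) • g x = (1 - ‖g x‖⁻¹ : ℝ) • g x := by
            rw [sub_smul, one_smul]
          rw [this, norm_smul, Real.norm_of_nonneg (by simpa using inv_le_one_of_one_le₀ h),
            sub_mul, one_mul, inv_mul_cancel₀ hg0]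
        calc _ ≤ ‖s x - g x‖ + ‖g x - (‖g x‖⁻¹ : ℝ) • g x‖ := norm_sub_le_norm_sub_add_norm_sub ..
          _ ≤ ‖s x - g x‖ + (‖g x‖ - ‖s x‖) := by rw [e]; linarith [h1 x]
          _ ≤ _ := by linarith [norm_sub_norm_le (g x) (s x), norm_sub_rev (g x) (s x)]
    calc ∫ x, ‖s x - f x‖ ∂ρ ≤ ∫ x, 2 * ‖s x - g x‖ ∂ρ :=
          integral_mono (hs.sub (integrable_continuousMap ρ f)).norm
            ((hs.sub hgi).norm.const_mul 2) hle
      _ ≤ ε := by rw [integral_const_mul]; linarith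

theorem norm_toDual_withDensityᵥ {ρ : Measure K} {h : K → ℂ} (hh : Integrable h ρ) :
    ‖toDual (ρ.withDensityᵥ h)‖ = ∫ x, ‖h x‖ ∂ρ := by
  apply le_antisymm
  · refine ContinuousLinearMap.opNorm_le_bound _ (integral_nonneg fun _ => norm_nonneg _) fun f => ?_
    rw [toDual_withDensityᵥ hh, mul_comm]
    exact norm_integral_continuousMap_mul_le hh f
  · refine le_of_forall_pos_le_add fun ε hε => ?_
    let s : K → ℂ := fun x => (‖h x‖ : ℂ) / h x
    have hs1 : ∀ x, ‖s x‖ ≤ 1 := fun x => by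
      simp only [s, norm_div, Complex.norm_real, norm_norm]; exact div_self_le_one _
    have hsm : AEStronglyMeasurable s ρ :=
      ((Complex.measurable_ofReal.comp_aemeasurable hh.1.norm.aemeasurable).div
        hh.1.aemeasurable).aestronglyMeasurable
    have hsi : Integrable s (ρ.withDensityᵥ h).variation :=
      Integrable.of_bound (hsm.mono_ac (variation_withDensityᵥ_ac hh)) 1
        (Filter.Eventually.of_forall hs1)
    -- The sign s attains the norm, since sh = |h|; a continuous function in the unit ball that is
    -- close to s in L^1 of |h|ρ almost attains it.
    obtain ⟨f, hf, hfs⟩ := exists_continuousMap_norm_le_one hsi hs1 hε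
    have hsf : Integrable (fun x => s x - f x) (ρ.withDensityᵥ h).variation :=
      hsi.sub (integrable_continuousMap (ρ.withDensityᵥ h).variation f)
    have e1 : (((∫ x, ‖h x‖ ∂ρ : ℝ)) : ℂ) = ∫ x, s x * h x ∂ρ := by
      rw [← integral_complex_ofReal]
      refine integral_congr_ae (Filter.Eventually.of_forall fun x => ?_)
      by_cases h0 : h x = 0
      · simp [h0]
      · simp only [s]; field_simp
    have e2 : ∫ x, s x * h x ∂ρ
        = toDual (ρ.withDensityᵥ h) f + ∫ x, (s x - f x) * h x ∂ρ := by
      rw [toDual_withDensityᵥ hh, ← integral_add (integrable_continuousMap_mul hh f)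
        ((integrable_variation_withDensityᵥ_iff hh).1 hsf)]
      refine integral_congr_ae (Filter.Eventually.of_forall fun x => ?_)
      simp only; ring
    have e3 : ‖∫ x, (s x - f x) * h x ∂ρ‖ ≤ ε := by
      refine (norm_integral_le_integral_norm _).trans ?_
      rw [← integral_norm_variation_withDensityᵥ hh]
      exact hfs
    have e4 : ‖toDual (ρ.withDensityᵥ h) f‖ ≤ ‖toDual (ρ.withDensityᵥ h)‖ :=
      ((toDual (ρ.withDensityᵥ h)).le_opNorm f).trans (mul_le_of_le_one_right (norm_nonneg _) hf)
    have e5 : ‖(((∫ x, ‖h x‖ ∂ρ : ℝ)) : ℂ)‖ = ∫ x, ‖h x‖ ∂ρ := by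
      rw [Complex.norm_real, Real.norm_of_nonneg (integral_nonneg fun _ => norm_nonneg _)]
    rw [← e5, e1, e2]
    exact (norm_add_le _ _).trans (add_le_add e4 e3)

theorem norm_toDual (ν : ComplexMeasure K) : ‖toDual ν‖ = (ν.variation Set.univ).toReal := by
  obtain ⟨ρ, _, h, -, hi, -, rfl, -⟩ := exists_common_density ν ν
  rw [norm_toDual_withDensityᵥ hi, variation_univ_withDensityᵥ hi]

theorem toDual_surjective : Function.Surjective (toDual (K := K)) := fun φ => by
  obtain ⟨ρ, _, h, hi, hφ⟩ := exists_density_eq_functional φ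
  exact ⟨ρ.withDensityᵥ h, ContinuousLinearMap.ext fun g => by rw [toDual_withDensityᵥ hi, hφ]⟩

/-- In norm, absolutely continuous measures are limits of continuous multiples. A closed subspace
stable under multiplication by `C(K)` is therefore stable under absolute continuity. -/
theorem exists_continuousMap_approx {ν ν' : ComplexMeasure K} (H : ν'.variation ≪ ν.variation)
    {ε : ℝ} (hε : 0 < ε) : ∃ g : C(K, ℂ), ‖toDual ν' - modAct g (toDual ν)‖ ≤ ε := by
  obtain ⟨k, hk, ek⟩ := exists_density H
  obtain ⟨h, hh, eh⟩ := exists_density_self ν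
  -- Polar decomposition of `ν`: as |h| = 1, approximating k by gh in L^1 amounts to approximating k
  -- times the conjugate of h by g.
  have hone : ∀ᵐ x ∂ν.variation, ‖h x‖ = 1 := by
    have h1 : ν.variation.withDensity (fun x => ‖h x‖ₑ) = ν.variation.withDensity fun _ => 1 := by
      rw [← Measure.variation_withDensityᵥ hh, ← eh]
      exact (withDensity_one (μ := ν.variation)).symm
    have h2 := (withDensity_eq_iff_of_sigmaFinite hh.1.enorm aemeasurable_const).1 h1
    filter_upwards [h2] with x hx
    rw [← toReal_enorm, hx]; simp
  generalize ν.variation = ρ at *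
  subst ek eh
  have hc : Integrable (fun x => k x * (starRingEnd ℂ) (h x)) ρ := by
    refine hk.mul_bdd (c := 1) (Complex.continuous_conj.comp_aestronglyMeasurable hh.1) ?_
    filter_upwards [hone] with x hx
    simp [hx]
  have : IsFiniteMeasure ρ := by
    have h3 := (integrable_congr hone).1 hh.norm
    rcases (integrable_const_iff (μ := ρ) (c := (1 : ℝ))).1 h3 with h | h
    · simp at h
    · exact h
  obtain ⟨g, hg, hgi⟩ := hc.exists_boundedContinuous_integral_sub_le hε
  have hd : Integrable (fun x => k x - g x * h x) ρ :=
    hk.sub (integrable_continuousMap_mul hh g.toContinuousMap)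
  have e : toDual (ρ.withDensityᵥ k) - modAct g.toContinuousMap (toDual (ρ.withDensityᵥ h))
      = toDual (ρ.withDensityᵥ fun x => k x - g x * h x) := by
    ext f
    rw [toDual_withDensityᵥ hd, sub_apply,
      toDual_withDensityᵥ hk, modAct, ContinuousLinearMap.comp_apply, toDual_withDensityᵥ hh,
      ← integral_sub (integrable_continuousMap_mul hk f) (integrable_continuousMap_mul hh _)]
    refine integral_congr_ae (Filter.Eventually.of_forall fun x => ?_)
    simp only [ContinuousLinearMap.mul_apply', ContinuousMap.mul_apply]
    change f x * k x - g x * f x * h x = f x * (k x - g x * h x)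
    ring
  refine ⟨g.toContinuousMap, ?_⟩
  rw [e, norm_toDual_withDensityᵥ hd]
  refine (integral_congr_ae ?_).trans_le hg
  filter_upwards [hone] with x hx
  have hcc : (starRingEnd ℂ) (h x) * h x = 1 := by
    rw [mul_comm, Complex.mul_conj, Complex.normSq_eq_norm_sq, hx]; simp
  have : k x - g x * h x = (k x * (starRingEnd ℂ) (h x) - g x) * h x := by
    rw [sub_mul, mul_assoc, hcc, mul_one]
  rw [this, norm_mul, hx, mul_one]

end DualSpace

/-! ### Weak compactness, the bidual and separability modulo the annihilator. -/

section Functionals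

variable {E : Type*} [NormedAddCommGroup E] [NormedSpace ℂ E]

/-- The functionals that vanish on a subspace. -/
def perp (p : Submodule ℂ E) : Submodule ℂ (StrongDual ℂ E) where
  carrier := {φ | ∀ x ∈ p, φ x = 0}
  zero_mem' := fun _ _ => rfl
  add_mem' := fun h₁ h₂ x hx => by simp [h₁ x hx, h₂ x hx]
  smul_mem' := fun c φ h x hx => by simp [h x hx]

theorem mem_perp {p : Submodule ℂ E} {φ : StrongDual ℂ E} : φ ∈ perp p ↔ ∀ x ∈ p, φ x = 0 :=
  Iff.rfl

/-- A norming functional of the quotient by p, pulled back to E. -/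
theorem exists_mem_perp_apply_eq_norm (p : Submodule ℂ E) (x : E) :
    ∃ φ ∈ perp p, ‖φ‖ ≤ 1 ∧ φ x = ‖p.mkQ x‖ := by
  obtain ⟨g, hg, hgx⟩ := exists_dual_vector'' ℂ (p.mkQ x)
  refine ⟨g.comp p.mkQL, fun y hy => ?_, ?_, hgx⟩
  · change g (p.mkQ y) = 0
    rw [Submodule.mkQ_apply, (Submodule.Quotient.mk_eq_zero p).2 hy, map_zero]
  · refine ContinuousLinearMap.opNorm_le_bound _ zero_le_one fun y => ?_
    exact (g.le_of_opNorm_le hg _).trans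
      (mul_le_mul_of_nonneg_left (Submodule.Quotient.norm_mk_le p y) zero_le_one)

theorem mem_of_norm_mkQ_eq_zero {p : Submodule ℂ E} (hp : IsClosed (p : Set E)) {x : E}
    (hx : ‖p.mkQ x‖ = 0) : x ∈ p := by
  have : x ∈ closure (p.toAddSubgroup : Set E) :=
    (QuotientAddGroup.norm_mk_eq_zero_iff_mem_closure (S := p.toAddSubgroup)).1 hx
  exact hp.closure_subset this

theorem mem_of_forall_perp {p : Submodule ℂ E} (hp : IsClosed (p : Set E)) {x : E}
    (hx : ∀ φ ∈ perp p, φ x = 0) : x ∈ p := by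
  obtain ⟨φ, hφ, -, h⟩ := exists_mem_perp_apply_eq_norm p x
  exact mem_of_norm_mkQ_eq_zero hp (by rw [hx φ hφ] at h; exact_mod_cast h.symm)

/-- In a separable space a closed subspace is cut out by countably many functionals. -/
theorem exists_seq_perp [TopologicalSpace.SeparableSpace E] {p : Submodule ℂ E}
    (hp : IsClosed (p : Set E)) :
    ∃ φ : ℕ → StrongDual ℂ E, (∀ n, φ n ∈ perp p) ∧ ∀ x, (∀ n, φ n x = 0) → x ∈ p := by
  choose φ hφ h1 h2 using exists_mem_perp_apply_eq_norm p
  let u := TopologicalSpace.denseSeq E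
  refine ⟨fun n => φ (u n), fun n => hφ _, fun x hx => mem_of_norm_mkQ_eq_zero hp ?_⟩
  refine le_antisymm (le_of_forall_pos_le_add fun ε hε => ?_) (norm_nonneg _)
  obtain ⟨n, hn⟩ := (TopologicalSpace.denseRange_denseSeq E).exists_dist_lt x (half_pos hε)
  have e1 : ‖p.mkQ (u n)‖ ≤ ‖u n - x‖ := by
    have : ((‖p.mkQ (u n)‖ : ℝ) : ℂ) = φ (u n) (u n - x) := by
      rw [map_sub, hx n, sub_zero, h2]
    calc ‖p.mkQ (u n)‖ = ‖((‖p.mkQ (u n)‖ : ℝ) : ℂ)‖ := by simp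
      _ ≤ 1 * ‖u n - x‖ := by rw [this]; exact (φ (u n)).le_of_opNorm_le (h1 _) _
      _ = _ := one_mul _
  have e2 : ‖p.mkQ x‖ ≤ ‖x - u n‖ + ‖p.mkQ (u n)‖ := by
    have : p.mkQ x = p.mkQ (x - u n) + p.mkQ (u n) := by rw [← map_add, sub_add_cancel]
    rw [this]
    exact (norm_add_le _ _).trans (add_le_add (Submodule.Quotient.norm_mk_le p _) le_rfl)
  rw [dist_eq_norm] at hn
  rw [norm_sub_rev] at e1
  linarith

theorem exists_smul_norm_le_one (x : E) : ∃ c : ℂ, c ≠ 0 ∧ ‖c • x‖ ≤ 1 := by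
  have hpos : 0 < ‖x‖ + 1 := by positivity
  refine ⟨((‖x‖ + 1)⁻¹ : ℝ), by exact_mod_cast (inv_pos.2 hpos).ne', ?_⟩
  rw [norm_smul, Complex.norm_real, norm_inv, Real.norm_of_nonneg hpos.le,
    inv_mul_le_iff₀ hpos]
  linarith

/-- Goldstine's theorem for a subspace `p`: a functional of norm at most one on the dual, which
vanishes on `p^⊥`, is approximated by the points of the unit ball of `p`. -/
theorem exists_approx_of_perp (p : Submodule ℂ E) (Φ : StrongDual ℂ (StrongDual ℂ E))
    (h1 : ‖Φ‖ ≤ 1) (hΦ : ∀ φ ∈ perp p, Φ φ = 0) (s : Finset (StrongDual ℂ E)) {ε : ℝ}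
    (hε : 0 < ε) : ∃ f ∈ p, ‖f‖ ≤ 1 ∧ ∀ φ ∈ s, ‖φ f - Φ φ‖ < ε := by
  classical
  let T : E →ₗ[ℂ] (s → ℂ) := LinearMap.pi fun φ => (φ : StrongDual ℂ E).toLinearMap
  let v : s → ℂ := fun φ => Φ φ
  let B : Set E := (p : Set E) ∩ Metric.closedBall 0 1
  have hB : Convex ℝ B :=
    (p.restrictScalars ℝ).convex.inter (convex_closedBall 0 1)
  by_cases hv : v ∈ closure (T '' B)
  · obtain ⟨_, ⟨f, hf, rfl⟩, hfv⟩ := Metric.mem_closure_iff.1 hv ε hε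
    refine ⟨f, hf.1, by simpa using hf.2, fun φ hφ => ?_⟩
    have := (dist_pi_lt_iff hε).1 hfv ⟨φ, hφ⟩
    rwa [dist_comm, dist_eq_norm] at this
  · exfalso
    have hc : Convex ℝ (closure (T '' B)) := by
      refine Convex.closure ?_
      exact hB.linear_image (T.restrictScalars ℝ)
    obtain ⟨l, u, hlu, hl⟩ := RCLike.geometric_hahn_banach_point_closed (𝕜 := ℂ) hc
      isClosed_closure hv
    let φ : StrongDual ℂ E := ∑ i : s, l (Pi.single i 1) • (i : StrongDual ℂ E)
    have hlin : ∀ w : s → ℂ, l w = ∑ i, l (Pi.single i 1) * w i := fun w => by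
      have := LinearMap.pi_apply_eq_sum_univ l.toLinearMap w
      refine this.trans (Finset.sum_congr rfl fun i _ => ?_)
      rw [smul_eq_mul, mul_comm]
      have : (fun j => if i = j then (1 : ℂ) else 0) = Pi.single i 1 := by
        ext j
        by_cases hj : i = j
        · subst hj; simp
        · simp [hj, Ne.symm hj]
      rw [this]
      rfl
    have hlT : ∀ f, l (T f) = φ f := fun f => by
      rw [hlin]
      simp [φ, T]
    have hlv : l v = Φ φ := by
      rw [hlin]
      simp [φ, v, map_sum]
    have hball : ∀ f ∈ p, ‖f‖ ≤ 1 → u < (φ f).re := fun f hf hf1 => by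
      have := hl (T f) (subset_closure ⟨f, ⟨hf, by simpa using hf1⟩, rfl⟩)
      rwa [hlT] at this
    have hu : u < 0 := by simpa using hball 0 p.zero_mem (by simp)
    have hbd : ∀ f : p, ‖f‖ ≤ 1 → ‖φ f‖ ≤ -u := fun f hf => by
      by_cases h0 : φ f = 0
      · rw [h0, norm_zero]; linarith
      · have hn : ‖φ f‖ ≠ 0 := norm_ne_zero_iff.2 h0
        let c : ℂ := -(‖φ f‖ / φ f)
        have hc1 : ‖c‖ = 1 := by simp [c, hn]
        have := hball (c • (f : E)) (p.smul_mem c f.2) (by rw [norm_smul, hc1, one_mul]; exact hf)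
        have e : φ (c • (f : E)) = ((-‖φ f‖ : ℝ) : ℂ) := by
          rw [map_smul, smul_eq_mul]
          simp only [c]
          push_cast
          field_simp
        rw [e, Complex.ofReal_re] at this
        linarith
    -- On p the functional φ has norm at most -u. A Hahn-Banach extension keeps this bound and
    -- differs from φ by an element of p^⊥, which Φ does not see.
    obtain ⟨φ', hφ', hn⟩ := exists_extension_norm_eq p (φ.comp p.subtypeL)
    have hφn : ‖φ'‖ ≤ -u := by
      rw [hn]
      refine ContinuousLinearMap.opNorm_le_of_unit_norm (𝕜 := ℂ) (by linarith) fun f hf => ?_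
      exact hbd f hf.le
    have heq : Φ φ = Φ φ' := by
      rw [← sub_eq_zero, ← map_sub]
      refine hΦ _ fun f hf => ?_
      rw [sub_apply, hφ' ⟨f, hf⟩]
      simp
    have hle : ‖Φ φ‖ ≤ -u := by
      rw [heq]
      exact ((Φ.le_of_opNorm_le h1 _).trans_eq (one_mul _)).trans hφn
    rw [hlv] at hlu
    have := (Complex.abs_re_le_norm (Φ φ))
    have h3 := neg_abs_le (Φ φ).re
    have h4 : (Φ φ).re < u := hlu
    linarith

/-- Weak compactness of `f ↦ L f + X` in terms of the bidual: `L^{**} Φ ∈ E + X^{⊥⊥}` for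
`Φ ∈ X^{⊥⊥}` in the unit ball. -/
theorem exists_repr_of_isWeaklyCompact_of_norm_le_one {X : Submodule ℂ E} {L : E →L[ℂ] E}
    (hL : IsWeaklyCompactOperator (X.mkQL.comp (L.comp X.subtypeL)))
    (Φ : StrongDual ℂ (StrongDual ℂ E)) (h1 : ‖Φ‖ ≤ 1) (hΦ : ∀ φ ∈ perp X, Φ φ = 0) :
    ∃ h : E, ∀ φ ∈ perp X, Φ (φ.comp L) = φ h := by
  have hex : ∀ s : Finset (StrongDual ℂ E), ∃ f : X, ‖f‖ ≤ 1 ∧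
      ∀ φ ∈ s, ‖φ f - Φ φ‖ < 1 / ((s.card : ℝ) + 1) := fun s => by
    obtain ⟨f, hf, hf1, h⟩ := exists_approx_of_perp X Φ h1 hΦ s
      (ε := 1 / ((s.card : ℝ) + 1)) (by positivity)
    exact ⟨⟨f, hf⟩, hf1, h⟩
  choose f hf1 hf using hex
  have hlim : ∀ φ : StrongDual ℂ E,
      Filter.Tendsto (fun s => φ (f s)) Filter.atTop (nhds (Φ φ)) := fun φ => by
    classical
    rw [Metric.tendsto_atTop]
    intro ε hε
    by_cases h0 : Subsingleton (StrongDual ℂ E)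
    · refine ⟨∅, fun s _ => ?_⟩
      rw [Subsingleton.elim φ 0]
      simpa using hε
    · rw [not_subsingleton_iff_nontrivial] at h0
      -- An infinite dual has finite subsets of every cardinality, so the tolerance 1/(card + 1)
      -- tends to zero along the finite sets.
      have := Module.Free.infinite ℂ (StrongDual ℂ E)
      obtain ⟨n, hn⟩ := exists_nat_one_div_lt hε
      obtain ⟨t, ht⟩ := Infinite.exists_subset_card_eq (StrongDual ℂ E) n
      refine ⟨insert φ t, fun s hs => ?_⟩
      rw [dist_eq_norm]
      refine (hf s φ (hs (Finset.mem_insert_self _ _))).trans (lt_of_le_of_lt ?_ hn)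
      have : n ≤ s.card := by
        rw [← ht]
        exact Finset.card_le_card ((Finset.subset_insert _ _).trans hs)
      gcongr
  let U : Ultrafilter (Finset (StrongDual ℂ E)) := Ultrafilter.of Filter.atTop
  have hU : (U : Filter (Finset (StrongDual ℂ E))) ≤ Filter.atTop :=
    Ultrafilter.of_le Filter.atTop
  -- Along an ultrafilter the points f_s tend to Φ on functionals, while the cosets of L f_s
  -- converge weakly in E/X; comparing the two limits on X^⊥ identifies h.
  obtain ⟨y, -, hy⟩ := IsCompact.ultrafilter_le_nhds hL
    (U.map fun s => toWeakSpace ℂ (E ⧸ X) (X.mkQL.comp (L.comp X.subtypeL) (f s))) (by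
      rw [Ultrafilter.coe_map, Filter.le_principal_iff, Filter.mem_map]
      refine Filter.univ_mem' fun s => subset_closure ⟨_, ⟨f s, ?_, rfl⟩, rfl⟩
      rw [mem_closedBall_zero_iff]
      exact hf1 s)
  obtain ⟨h, rfl⟩ : ∃ h : E, toWeakSpace ℂ (E ⧸ X) (X.mkQ h) = y := by
    obtain ⟨z, rfl⟩ := (toWeakSpace ℂ (E ⧸ X)).surjective y
    obtain ⟨h, rfl⟩ := X.mkQ_surjective z
    exact ⟨h, rfl⟩
  refine ⟨h, fun φ hφ => ?_⟩
  let φ' : StrongDual ℂ (E ⧸ X) := X.liftQL φ fun x hx => hφ x hx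
  have hcont : Continuous fun w : WeakSpace ℂ (E ⧸ X) => φ' ((toWeakSpace ℂ (E ⧸ X)).symm w) :=
    WeakBilin.eval_continuous (topDualPairing ℂ (E ⧸ X)).flip φ'
  have t1 : Filter.Tendsto (fun s => φ (L (f s))) U (nhds (φ h)) :=
    (hcont.tendsto _).comp hy
  have t2 : Filter.Tendsto (fun s => φ (L (f s))) U (nhds (Φ (φ.comp L))) :=
    (hlim (φ.comp L)).mono_left hU
  exact tendsto_nhds_unique t2 t1

theorem exists_repr_of_isWeaklyCompact {X : Submodule ℂ E} {L : E →L[ℂ] E}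
    (hL : IsWeaklyCompactOperator (X.mkQL.comp (L.comp X.subtypeL)))
    (Φ : StrongDual ℂ (StrongDual ℂ E)) (hΦ : ∀ φ ∈ perp X, Φ φ = 0) :
    ∃ h : E, ∀ φ ∈ perp X, Φ (φ.comp L) = φ h := by
  obtain ⟨c, hc, h1⟩ := exists_smul_norm_le_one Φ
  obtain ⟨h, hh⟩ := exists_repr_of_isWeaklyCompact_of_norm_le_one hL (c • Φ) h1
    (fun φ hφ => by simp [hΦ φ hφ])
  refine ⟨c⁻¹ • h, fun φ hφ => ?_⟩
  rw [map_smul, ← hh φ hφ, smul_apply, smul_smul, inv_mul_cancel₀ hc, one_smul]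

/-- Separability of the band modulo `X^⊥`: if all the operators `f ↦ L_g f + X` are weakly compact,
then countably many of the functionals `φ ∘ L_g`, `φ ∈ X^⊥`, span modulo `X^⊥` all of them up to
closure. -/
theorem exists_countable_span_dense [TopologicalSpace.SeparableSpace E] {X : Submodule ℂ E}
    (hX : IsClosed (X : Set E)) (L : E →L[ℂ] E →L[ℂ] E)
    (hL : ∀ g, IsWeaklyCompactOperator (X.mkQL.comp ((L g).comp X.subtypeL))) :
    ∃ c : Set (StrongDual ℂ E), c.Countable ∧
      (∀ ψ ∈ c, ∃ φ ∈ perp X, ∃ g, ψ = φ.comp (L g)) ∧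
      ∀ φ ∈ perp X, ∀ g, φ.comp (L g) ∈ (Submodule.span ℂ c ⊔ perp X).topologicalClosure := by
  obtain ⟨φ, hφ, hφX⟩ := exists_seq_perp hX
  let u := TopologicalSpace.denseSeq E
  refine ⟨Set.range fun n : ℕ × ℕ => (φ n.1).comp (L (u n.2)), Set.countable_range _, ?_, ?_⟩
  · rintro _ ⟨n, rfl⟩
    exact ⟨_, hφ _, _, rfl⟩
  intro ψ hψ g
  -- By Hahn-Banach it suffices that each Φ in the bidual which kills X^⊥ and the countable set also
  -- kills ψ ∘ L_g.
  refine mem_of_forall_perp (Submodule.isClosed_topologicalClosure _) fun Φ hΦ => ?_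
  have hΦ0 : ∀ θ ∈ perp X, Φ θ = 0 := fun θ hθ =>
    hΦ θ (Submodule.le_topologicalClosure _ (Submodule.mem_sup_right hθ))
  have hdense : ∀ k, Φ (ψ.comp (L (u k))) = 0 := fun k => by
    obtain ⟨h, hh⟩ := exists_repr_of_isWeaklyCompact (hL (u k)) Φ hΦ0
    have hhX : h ∈ X := hφX h fun n => by
      rw [← hh _ (hφ n)]
      exact hΦ _ (Submodule.le_topologicalClosure _ (Submodule.mem_sup_left
        (Submodule.subset_span ⟨(n, k), rfl⟩)))
    rw [hh ψ hψ]
    exact hψ h hhX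
  have hcont : Continuous fun g => Φ (ψ.comp (L g)) := by fun_prop
  exact congrFun (Continuous.ext_on (TopologicalSpace.denseRange_denseSeq E) hcont
    continuous_const (by rintro _ ⟨k, rfl⟩; exact hdense k)) g

end Functionals

/-! ### Lifting a separable quotient with control of the norm. -/

section Lifting

variable {E : Type*} [NormedAddCommGroup E] [NormedSpace ℂ E]

theorem isSeparable_image_mkQ {P B : Submodule ℂ E} {c : Set E} (hc : c.Countable)
    (hB : B ≤ (Submodule.span ℂ c ⊔ P).topologicalClosure) :
    TopologicalSpace.IsSeparable (P.mkQ '' B) := by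
  have h1 : TopologicalSpace.IsSeparable (P.mkQL '' (Submodule.span ℂ c : Set E)) :=
    (hc.isSeparable.span (R := ℂ)).image P.mkQL.continuous
  refine h1.closure.mono ?_
  rintro _ ⟨x, hx, rfl⟩
  have hx' : x ∈ closure ((Submodule.span ℂ c ⊔ P : Submodule ℂ E) : Set E) := hB hx
  have := image_closure_subset_closure_image P.mkQL.continuous ⟨x, hx', rfl⟩
  refine closure_mono ?_ this
  rintro _ ⟨y, hy, rfl⟩
  obtain ⟨a, ha, b, hb, rfl⟩ := Submodule.mem_sup.1 hy
  refine ⟨a, ha, ?_⟩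
  change P.mkQ a = P.mkQ (a + b)
  rw [map_add, Submodule.mkQ_apply P b, (Submodule.Quotient.mk_eq_zero P).2 hb, add_zero]

/-- If `B / P` is separable, then countably many elements of `B` suffice to lift `B / P`, with
control of the norm, through any operator from a Banach space that attains them isometrically. -/
theorem exists_seq_lifting {P B : Submodule ℂ E} (hP : IsClosed (P : Set E)) (hPB : P ≤ B)
    (hsep : TopologicalSpace.IsSeparable (P.mkQ '' B)) :
    ∃ e : ℕ → E, (∀ n, e n ∈ B) ∧ ∀ {G : Type _} [NormedAddCommGroup G] [NormedSpace ℂ G]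
      [CompleteSpace G] (J : G →L[ℂ] E), (∀ h, ‖J h‖ = ‖h‖) → (∀ n, ∃ h, J h = e n) →
      ∀ C : ℝ, 1 < C → ∀ φ ∈ B, ∃ h, J h - φ ∈ P ∧ ‖h‖ ≤ C * ‖φ‖ := by
  obtain ⟨d, hdB, hdc, hd⟩ := hsep.exists_countable_dense_subset
  have : Countable d := hdc.to_subtype
  -- Integer combinations form a subgroup, as the successive approximation in
  -- `controlled_closure_of_complete` requires, and there are still only countably many.
  let k : (d →₀ ℤ) →ₗ[ℤ] (E ⧸ P) := Finsupp.linearCombination ℤ (Subtype.val : d → E ⧸ P)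
  have hk : ∀ q, k q ∈ B.map P.mkQ := fun q => by
    rw [Finsupp.linearCombination_apply]
    exact Submodule.sum_mem _ fun i _ => zsmul_mem (hdB i.2) _
  have hlift : ∀ (q : d →₀ ℤ) (n : ℕ), ∃ x ∈ B, P.mkQ x = k q ∧
      ‖x‖ ≤ (1 + 1 / ((n : ℝ) + 1)) * ‖k q‖ := fun q n => by
    -- The relative excess 1/(n + 1) leaves room for an almost minimal lift only if the coset has
    -- positive norm; the zero coset is lifted by 0.
    by_cases h0 : ‖k q‖ = 0
    · obtain ⟨y, hy, hyq⟩ := hk q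
      have hyP : y ∈ P := mem_of_norm_mkQ_eq_zero hP (by rw [hyq, h0])
      refine ⟨0, B.zero_mem, ?_, by simp [h0]⟩
      rw [map_zero, ← hyq, Submodule.mkQ_apply, (Submodule.Quotient.mk_eq_zero P).2 hyP]
    · have hpos : 0 < ‖k q‖ := lt_of_le_of_ne (norm_nonneg _) (Ne.symm h0)
      obtain ⟨x, hx, hxn⟩ := Submodule.Quotient.norm_mk_lt (k q)
        (show 0 < 1 / ((n : ℝ) + 1) * ‖k q‖ by positivity)
      obtain ⟨y, hy, hyq⟩ := hk q
      refine ⟨x, ?_, hx, by linarith⟩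
      have : x - y ∈ P := by
        rw [← Submodule.Quotient.eq, hx, ← hyq]; rfl
      have h2 := B.add_mem (hPB this) hy
      rwa [sub_add_cancel] at h2
  choose x hxB hxq hxn using hlift
  obtain ⟨r, hr⟩ := exists_surjective_nat ((d →₀ ℤ) × ℕ)
  refine ⟨fun n => x (r n).1 (r n).2, fun n => hxB _ _, ?_⟩
  intro G _ _ _ J hJ hJe C hC φ hφ
  let f : NormedAddGroupHom G (E ⧸ P) :=
    (P.mkQL.comp J).toLinearMap.toAddMonoidHom.mkNormedAddGroupHom 1 fun h => by
      rw [one_mul, ← hJ h]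
      exact Submodule.Quotient.norm_mk_le P _
  have hf : ∀ h, f h = P.mkQ (J h) := fun h => rfl
  obtain ⟨n, hn⟩ := exists_nat_one_div_lt (half_pos (sub_pos.2 hC))
  have hsurj : f.SurjectiveOnWith (LinearMap.range k).toAddSubgroup (1 + 1 / ((n : ℝ) + 1)) := by
    rintro _ ⟨q, rfl⟩
    obtain ⟨i, hi⟩ := hr (q, n)
    obtain ⟨h, hh⟩ := hJe i
    simp only [hi] at hh
    exact ⟨h, by rw [hf, hh, hxq], by rw [← hJ, hh]; exact hxn q n⟩
  have hcl := controlled_closure_of_complete (by positivity) (half_pos (sub_pos.2 hC)) hsurj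
  obtain ⟨h, hh, hn'⟩ := hcl (P.mkQ φ) (by
    refine closure_mono ?_ (hd ⟨φ, hφ, rfl⟩)
    intro y hy
    refine ⟨Finsupp.single ⟨y, hy⟩ 1, ?_⟩
    simp [k])
  refine ⟨h, (Submodule.Quotient.eq P).1 (hh : P.mkQ (J h) = P.mkQ φ), hn'.trans ?_⟩
  refine mul_le_mul (by linarith) (Submodule.Quotient.norm_mk_le P φ) (norm_nonneg _) (by linarith)

end Lifting

/-! ### The band generated by the annihilator is separable modulo the annihilator. -/

section ModuleAction

variable {K : Type*} [TopologicalSpace K] [CompactSpace K]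

theorem modAct_add (g : C(K, ℂ)) (φ ψ : StrongDual ℂ C(K, ℂ)) :
    modAct g (φ + ψ) = modAct g φ + modAct g ψ := rfl

theorem norm_modAct_sub_le (g : C(K, ℂ)) (φ ψ : StrongDual ℂ C(K, ℂ)) :
    ‖modAct g φ - modAct g ψ‖ ≤ ‖φ - ψ‖ * ‖g‖ := by
  have : modAct g φ - modAct g ψ = modAct g (φ - ψ) := rfl
  rw [this, modAct]
  refine (ContinuousLinearMap.opNorm_comp_le _ _).trans ?_
  gcongr
  exact ContinuousLinearMap.opNorm_mul_apply_le ℂ _ g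

end ModuleAction

section Band

variable {K : Type*} [MetricSpace K] [CompactSpace K] [MeasurableSpace K] [BorelSpace K]

theorem mem_annihilator_iff {X : Submodule ℂ C(K, ℂ)} {ν : ComplexMeasure K} :
    ν ∈ annihilator X ↔ toDual ν ∈ perp X := Iff.rfl

theorem norm_toDual_sub_lt {μ ν : ComplexMeasure K} {ε : ℝ}
    (h : (μ - ν).variation Set.univ < ENNReal.ofReal ε) : ‖toDual μ - toDual ν‖ < ε := by
  rw [← map_sub, norm_toDual]
  exact ENNReal.toReal_lt_of_lt_ofReal h

/-- The measures `ν` with `g ν ∈ V` for all `g ∈ C(K)` form a band if `V` is norm closed. -/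
theorem bandPerp_le_of_forall_modAct {X : Submodule ℂ C(K, ℂ)}
    {V : Submodule ℂ (StrongDual ℂ C(K, ℂ))}
    (hV : IsClosed (V : Set (StrongDual ℂ C(K, ℂ))))
    (H : ∀ φ ∈ perp X, ∀ g, modAct g φ ∈ V) : (bandPerp X).map toDual ≤ V := by
  let B₁ : Submodule ℂ (ComplexMeasure K) :=
    { carrier := {ν | ∀ g, modAct g (toDual ν) ∈ V}
      zero_mem' := fun g => by
        rw [map_zero]; exact V.zero_mem
      add_mem' := fun {a b} ha hb g => by
        rw [map_add, modAct_add]; exact V.add_mem (ha g) (hb g)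
      smul_mem' := fun c a ha g => by
        rw [map_smul]; exact V.smul_mem c (ha g) }
  have hB₁ : IsBand B₁ := by
    constructor
    · intro μ hμ g
      rw [← SetLike.mem_coe, ← hV.closure_eq, Metric.mem_closure_iff]
      intro ε hε
      obtain ⟨ν, hν, hlt⟩ := hμ (ENNReal.ofReal (ε / (‖g‖ + 1)))
        (ENNReal.ofReal_pos.2 (by positivity))
      refine ⟨_, hν g, ?_⟩
      rw [dist_eq_norm]
      have h1 := norm_toDual_sub_lt hlt
      rw [lt_div_iff₀ (by positivity)] at h1
      refine (norm_modAct_sub_le _ _ _).trans_lt (lt_of_le_of_lt ?_ h1)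
      gcongr
      linarith
    · intro ν hν ν' hac g
      rw [← SetLike.mem_coe, ← hV.closure_eq, Metric.mem_closure_iff]
      intro ε hε
      -- The measure ν' is norm close to kν, and g(kν) = (kg)ν lies in V. This is why membership in
      -- B₁ is required of all multiples gν and not of ν alone.
      obtain ⟨k, hk⟩ := exists_continuousMap_approx hac
        (ε := ε / 2 / (‖g‖ + 1)) (by positivity)
      refine ⟨modAct g (modAct k (toDual ν)), ?_, ?_⟩
      · have : modAct g (modAct k (toDual ν)) = modAct (k * g) (toDual ν) := by
          ext f
          change toDual ν (k * (g * f)) = toDual ν (k * g * f)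
          rw [mul_assoc]
        rw [this]
        exact hν _
      · rw [dist_eq_norm]
        rw [le_div_iff₀ (by positivity)] at hk
        refine (norm_modAct_sub_le _ _ _).trans_lt (lt_of_le_of_lt ?_ (half_lt_self hε))
        refine le_trans ?_ hk
        gcongr
        linarith
  have hle : bandPerp X ≤ B₁ := sInf_le ⟨hB₁, fun μ hμ g => H _ hμ g⟩
  rintro _ ⟨ν, hν, rfl⟩
  have h1 := hle hν 1
  have : modAct 1 (toDual ν) = toDual ν := by
    ext f
    change toDual ν (1 * f) = toDual ν f
    rw [one_mul]
  rwa [this] at h1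

theorem annihilator_subset_bandPerp (X : Submodule ℂ C(K, ℂ)) {ν : ComplexMeasure K}
    (hν : ν ∈ annihilator X) : ν ∈ bandPerp X :=
  subset_bandGenerated _ hν

theorem mem_bandPerp_of_ac {X : Submodule ℂ C(K, ℂ)} {ν ν' : ComplexMeasure K}
    (hν : ν ∈ bandPerp X) (h : ν'.variation ≪ ν.variation) : ν' ∈ bandPerp X :=
  (isBand_bandGenerated _).mem_of_ac ν hν ν' h

theorem perp_le_map_bandPerp (X : Submodule ℂ C(K, ℂ)) : perp X ≤ (bandPerp X).map toDual := by
  intro φ hφ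
  obtain ⟨ν, rfl⟩ := toDual_surjective φ
  exact ⟨ν, annihilator_subset_bandPerp X hφ, rfl⟩

theorem isClosed_perp {E : Type*} [NormedAddCommGroup E] [NormedSpace ℂ E] (p : Submodule ℂ E) :
    IsClosed (perp p : Set (StrongDual ℂ E)) := by
  have : (perp p : Set (StrongDual ℂ E)) = ⋂ x ∈ p, {φ | φ x = 0} := by
    ext φ; simp [mem_perp]
  rw [this]
  exact isClosed_biInter fun x _ => isClosed_eq (by fun_prop) continuous_const

theorem isSeparable_bandPerp_mod {X : Submodule ℂ C(K, ℂ)} (hX : IsTight X) :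
    TopologicalSpace.IsSeparable ((perp X).mkQ '' ((bandPerp X).map toDual)) := by
  obtain ⟨c, hc, -, h⟩ := exists_countable_span_dense hX.isClosed
    (ContinuousLinearMap.mul ℂ C(K, ℂ)) hX.weaklyCompact
  exact isSeparable_image_mkQ hc
    (bandPerp_le_of_forall_modAct (Submodule.isClosed_topologicalClosure _) h)

end Band

/-! ### A single measure in the band that lifts the quotient. -/

section DominatingMeasure

variable {K : Type*} [MetricSpace K] [CompactSpace K] [MeasurableSpace K] [BorelSpace K]

theorem withDensityᵥ_one_add (ρ₁ ρ₂ : Measure K) [IsFiniteMeasure ρ₁] [IsFiniteMeasure ρ₂] :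
    (ρ₁ + ρ₂).withDensityᵥ (fun _ => (1 : ℂ))
      = ρ₁.withDensityᵥ (fun _ => (1 : ℂ)) + ρ₂.withDensityᵥ fun _ => (1 : ℂ) := by
  ext s hs
  rw [add_apply, withDensityᵥ_apply (integrable_const _) hs,
    withDensityᵥ_apply (integrable_const _) hs, withDensityᵥ_apply (integrable_const _) hs]
  simp [measureReal_add_apply]

/-- The positive measures in a band form a band of measures closed under countable sums. -/
theorem IsBand.withDensityᵥ_one_sum_mem {B : Submodule ℂ (ComplexMeasure K)} (hB : IsBand B)
    (ρ : ℕ → Measure K) [∀ n, IsFiniteMeasure (ρ n)] [IsFiniteMeasure (Measure.sum ρ)]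
    (h : ∀ n, (ρ n).withDensityᵥ (fun _ => (1 : ℂ)) ∈ B) :
    (Measure.sum ρ).withDensityᵥ (fun _ => (1 : ℂ)) ∈ B := by
  have hpart : ∀ n, (∑ i ∈ Finset.range n, ρ i).withDensityᵥ (fun _ => (1 : ℂ)) ∈ B := by
    intro n
    induction n with
    | zero =>
      have : (0 : Measure K).withDensityᵥ (fun _ => (1 : ℂ)) = 0 := by
        ext s hs
        rw [withDensityᵥ_apply (integrable_const _) hs]; simp
      simp only [Finset.range_zero, Finset.sum_empty]
      rw [this]
      exact B.zero_mem
    | succ n ih =>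
      rw [Finset.sum_range_succ, withDensityᵥ_one_add]
      exact B.add_mem ih (h n)
  refine hB.mem_of_approx _ fun ε hε => ?_
  have htot : ∑' n, ρ n Set.univ ≠ ∞ := by
    rw [← Measure.sum_apply _ MeasurableSet.univ]; exact measure_ne_top _ _
  -- The partial sums converge in norm, the error being the mass of the tail.
  obtain ⟨N, hN⟩ := ((ENNReal.tendsto_sum_nat_add _ htot).eventually (gt_mem_nhds hε)).exists
  refine ⟨_, hpart N, ?_⟩
  have hsplit : Measure.sum ρ = ∑ i ∈ Finset.range N, ρ i + Measure.sum fun k => ρ (k + N) := by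
    ext s hs
    rw [Measure.add_apply, Measure.sum_apply _ hs, Measure.sum_apply _ hs,
      Measure.finsetSum_apply]
    have := Summable.sum_add_tsum_nat_add' (f := fun n => ρ n s) (k := N) ENNReal.summable
    exact this.symm
  have hfin : IsFiniteMeasure (Measure.sum fun k => ρ (k + N)) := by
    refine isFiniteMeasure_of_le (Measure.sum ρ) ?_
    rw [hsplit]
    exact Measure.le_add_left le_rfl
  have : (Measure.sum ρ).withDensityᵥ (fun _ => (1 : ℂ))
      - (∑ i ∈ Finset.range N, ρ i).withDensityᵥ (fun _ => (1 : ℂ))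
      = (Measure.sum fun k => ρ (k + N)).withDensityᵥ fun _ => (1 : ℂ) := by
    rw [sub_eq_iff_eq_add', ← withDensityᵥ_one_add, ← hsplit]
  rw [this, variation_withDensityᵥ_one, Measure.sum_apply _ MeasurableSet.univ]
  exact hN

/-- Countably many measures of a band are dominated by a single one. -/
theorem IsBand.exists_dominating {B : Submodule ℂ (ComplexMeasure K)} (hB : IsBand B)
    (ν : ℕ → ComplexMeasure K) (hν : ∀ n, ν n ∈ B) :
    ∃ m ∈ B, ∀ n, (ν n).variation ≪ m.variation := by
  -- Positive weights making the sum of the variations finite.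
  obtain ⟨c, hc0, hc⟩ := ENNReal.exists_pos_tsum_mul_lt_of_countable (ι := ℕ) one_ne_zero
    (fun n => (ν n).variation Set.univ) fun n => measure_ne_top _ _
  let ρ : ℕ → Measure K := fun n => c n • (ν n).variation
  have hfin : IsFiniteMeasure (Measure.sum ρ) := by
    constructor
    rw [Measure.sum_apply _ MeasurableSet.univ]
    refine lt_of_le_of_lt (le_of_eq (tsum_congr fun n => ?_)) (hc.trans ENNReal.one_lt_top)
    change (c n : ℝ≥0∞) * (ν n).variation Set.univ = _
    rw [mul_comm]
  refine ⟨_, hB.withDensityᵥ_one_sum_mem ρ fun n => ?_, fun n => ?_⟩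
  · refine hB.mem_of_ac _ (hν n) _ ?_
    rw [variation_withDensityᵥ_one]
    exact Measure.smul_absolutelyContinuous
  · rw [variation_withDensityᵥ_one]
    refine Measure.AbsolutelyContinuous.trans ?_ (Measure.absolutelyContinuous_of_le
      (Measure.le_sum ρ n))
    exact Measure.absolutelyContinuous_smul (c := (c n : ℝ≥0∞))
      (by exact_mod_cast (hc0 n).ne')

/-- The embedding of `L^1(ρ)` into the dual of `C(K)`. -/
noncomputable def densityDual (ρ : Measure K) : Lp ℂ 1 ρ →L[ℂ] StrongDual ℂ C(K, ℂ) :=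
  LinearMap.mkContinuous
    { toFun := fun h => toDual (ρ.withDensityᵥ h)
      map_add' := fun f g => by
        rw [← map_add, ← withDensityᵥ_add (L1.integrable_coeFn f) (L1.integrable_coeFn g)]
        congr 1
        exact WithDensityᵥEq.congr_ae (Lp.coeFn_add f g)
      map_smul' := fun c f => by
        rw [RingHom.id_apply, ← map_smul, ← withDensityᵥ_smul]
        congr 1
        exact WithDensityᵥEq.congr_ae (Lp.coeFn_smul c f) } 1
    (fun h => by
      rw [one_mul, L1.norm_eq_integral_norm]
      exact (norm_toDual_withDensityᵥ (L1.integrable_coeFn h)).le)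

theorem densityDual_apply {ρ : Measure K} (h : Lp ℂ 1 ρ) :
    densityDual ρ h = toDual (ρ.withDensityᵥ h) := rfl

theorem norm_densityDual {ρ : Measure K} (h : Lp ℂ 1 ρ) : ‖densityDual ρ h‖ = ‖h‖ := by
  rw [densityDual_apply, norm_toDual_withDensityᵥ (L1.integrable_coeFn h), L1.norm_eq_integral_norm]

/-- For a tight space there is a measure `m` in the band such that every measure of the band is
equivalent modulo `X^⊥` to a measure `h|m|`, with control of the norm. -/
theorem exists_measure_lifting {X : Submodule ℂ C(K, ℂ)} (hX : IsTight X) :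
    ∃ m ∈ bandPerp X, ∀ C : ℝ, 1 < C → ∀ ν ∈ bandPerp X, ∃ h : K → ℂ, Integrable h m.variation ∧
      ν - m.variation.withDensityᵥ h ∈ annihilator X ∧
      ∫ x, ‖h x‖ ∂m.variation ≤ C * ‖toDual ν‖ := by
  obtain ⟨e, heB, he⟩ := exists_seq_lifting (isClosed_perp X) (perp_le_map_bandPerp X)
    (isSeparable_bandPerp_mod hX)
  choose ν hν hνe using heB
  -- Once |m| dominates the countable lifts, L^1(|m|) reaches each of them isometrically, which is
  -- all that the lifting of the whole quotient needs.
  obtain ⟨m, hm, hνm⟩ := (isBand_bandGenerated _).exists_dominating ν hν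
  refine ⟨m, hm, fun C hC μ hμ => ?_⟩
  obtain ⟨h, h1, h2⟩ := he (densityDual m.variation) norm_densityDual (fun n => by
    obtain ⟨k, hk, hkν⟩ := exists_density (hνm n)
    refine ⟨hk.toL1 k, ?_⟩
    rw [densityDual_apply, ← hνe n, hkν]
    congr 1
    exact WithDensityᵥEq.congr_ae hk.coeFn_toL1) C hC (toDual μ) ⟨μ, hμ, rfl⟩
  refine ⟨h, L1.integrable_coeFn h, ?_, by rwa [← L1.norm_eq_integral_norm]⟩
  rw [mem_annihilator_iff, map_sub, ← neg_mem_iff, neg_sub]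
  exact h1

end DominatingMeasure

/-! ### Closures in weak topologies given by a family of functionals. -/

section InducedClosure

variable {ι ι' Y Y' : Type*}

theorem apply_eq_zero_of_mem_closure_induced {p : Y → ι → ℂ} {s : Set Y} {y : Y}
    (hy : y ∈ @closure _ (TopologicalSpace.induced p Pi.topologicalSpace) s) {i : ι}
    (h : ∀ x ∈ s, p x i = 0) : p y i = 0 := by
  rw [closure_induced] at hy
  have hc : IsClosed {v : ι → ℂ | v i = 0} := isClosed_eq (continuous_apply i) continuous_const
  refine closure_minimal ?_ hc hy
  rintro _ ⟨x, hx, rfl⟩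
  exact h x hx

/-- Continuity of π: each functional defining the target topology, composed with π, is one of those
defining the source topology. -/
theorem mem_closure_induced_of_reindex {p : Y → ι → ℂ} {p' : Y' → ι' → ℂ} {π : Y → Y'}
    (r : ι' → ι) (h : ∀ y i, p' (π y) i = p y (r i)) {s : Set Y} {s' : Set Y'}
    (hs : ∀ x ∈ s, π x ∈ s') {y : Y}
    (hy : y ∈ @closure _ (TopologicalSpace.induced p Pi.topologicalSpace) s) :
    π y ∈ @closure _ (TopologicalSpace.induced p' Pi.topologicalSpace) s' := by
  rw [closure_induced] at hy ⊢
  have hr : Continuous fun (v : ι → ℂ) (i : ι') => v (r i) :=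
    continuous_pi fun i => continuous_apply _
  have e : ∀ y, p' (π y) = fun i => p y (r i) := fun y => funext (h y)
  rw [e]
  refine closure_mono ?_ (image_closure_subset_closure_image hr ⟨_, hy, rfl⟩)
  rintro _ ⟨_, ⟨x, hx, rfl⟩, rfl⟩
  exact ⟨π x, hs x hx, e x⟩

/-- The bipolar theorem for a subspace and a weak topology given by a family of functionals. -/
theorem mem_closure_induced_of_annihilates {V : Type*} [AddCommGroup V] [Module ℂ V]
    (X : Submodule ℂ V) {j : V → Y} {p : Y → ι → ℂ} (q : ι → V →ₗ[ℂ] ℂ)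
    (hpq : ∀ f i, p (j f) i = q i f) {y : Y}
    (H : ∀ (s : Finset ι) (c : ι → ℂ), (∀ f ∈ X, ∑ i ∈ s, c i * q i f = 0) →
      ∑ i ∈ s, c i * p y i = 0) :
    y ∈ @closure _ (TopologicalSpace.induced p Pi.topologicalSpace) (j '' X) := by
  classical
  rw [closure_induced, mem_closure_iff]
  intro o ho hyo
  obtain ⟨s, u, hu, hsu⟩ := isOpen_pi_iff.1 ho _ hyo
  let T : V →ₗ[ℂ] (s → ℂ) := LinearMap.pi fun i => q i
  -- A basic neighbourhood sees finitely many coordinates, and there some f ∈ X attains the values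
  -- of y exactly, because subspaces of a finite-dimensional space are cut out by functionals.
  have hmem : (fun i : s => p y i) ∈ X.map T := by
    by_contra hnot
    obtain ⟨l, hl, hl0⟩ := Submodule.exists_dual_map_eq_bot_of_notMem hnot inferInstance
    have hlin : ∀ w : s → ℂ, l w = ∑ i, l (Pi.single i 1) * w i := fun w => by
      refine (LinearMap.pi_apply_eq_sum_univ l w).trans (Finset.sum_congr rfl fun i _ => ?_)
      rw [smul_eq_mul, mul_comm]
      have : (fun j => if i = j then (1 : ℂ) else 0) = Pi.single i 1 := by
        ext j
        by_cases hj : i = j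
        · subst hj; simp
        · simp [hj, Ne.symm hj]
      rw [this]
    let c : ι → ℂ := fun i => if hi : i ∈ s then l (Pi.single ⟨i, hi⟩ 1) else 0
    have hc : ∀ w : ι → ℂ, ∑ i ∈ s, c i * w i = l fun i : s => w i := fun w => by
      rw [hlin, ← Finset.sum_coe_sort]
      refine Finset.sum_congr rfl fun i _ => ?_
      simp [c]
    refine hl ?_
    rw [← hc]
    refine H s c fun f hf => ?_
    rw [hc fun i => q i f]
    have : l (T f) ∈ Submodule.map l (X.map T) := ⟨_, ⟨f, hf, rfl⟩, rfl⟩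
    rw [hl0] at this
    exact this
  obtain ⟨f, hf, hfT⟩ := hmem
  refine ⟨p (j f), hsu fun i hi => ?_, ⟨_, ⟨f, hf, rfl⟩, rfl⟩⟩
  have : q i f = p y i := congrFun hfT ⟨i, hi⟩
  rw [hpq, this]
  exact (hu i hi).2

end InducedClosure

/-! ### From complex to positive representing measures; points off the Choquet boundary. -/

section Representing

variable {K : Type*} [MetricSpace K] [CompactSpace K] [MeasurableSpace K] [BorelSpace K]

/-- A point with a complex representing measure `h ρ` has a representing measure which is
absolutely continuous with respect to `ρ`. -/
theorem exists_isRepresenting_of_density (A : Subalgebra ℂ C(K, ℂ)) (z : K) {ρ : Measure K}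
    {h : K → ℂ} (hh : Integrable h ρ) (hz : ∀ f ∈ A, ∫ x, f x * h x ∂ρ = f z) :
    ∃ μ : Measure K, IsRepresenting A z μ ∧ μ ≪ ρ := by
  let η : Measure K := ρ.withDensity fun x => ‖h x‖ₑ
  have hη : η = (ρ.withDensityᵥ h).variation := (Measure.variation_withDensityᵥ hh).symm
  have : IsFiniteMeasure η := by rw [hη]; infer_instance
  let ι : C(K, ℂ) →L[ℂ] Lp ℂ 2 η := ContinuousMap.toLp 2 η ℂ
  have hι : ∀ f : C(K, ℂ), ι f =ᵐ[η] f := fun f => ContinuousMap.coeFn_toLp η f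
  -- Evaluation at z is bounded on `A` in L^2(η), by Cauchy-Schwarz applied to |f(z)| ≤ ∫ |f| dη.
  have hbound : ∃ C : ℝ, ∀ f ∈ A, ‖f z‖ ≤ C * ‖ι f‖ := by
    refine ⟨‖ι 1‖, fun f hf => ?_⟩
    rw [← hz f hf]
    refine (norm_integral_le_integral_norm _).trans ?_
    rw [← integral_norm_variation_withDensityᵥ hh, ← hη]
    let n : C(K, ℂ) := ⟨fun x => (‖f x‖ : ℂ), by fun_prop⟩
    have e : ((∫ x, ‖f x‖ ∂η : ℝ) : ℂ) = inner ℂ (ι 1) (ι n) := by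
      rw [L2.inner_def, ← integral_complex_ofReal]
      refine integral_congr_ae ?_
      filter_upwards [hι 1, hι n] with x h1 h2
      rw [h1, h2]
      simp [n]
    have e2 : ‖ι n‖ = ‖ι f‖ := by
      rw [Lp.norm_def, Lp.norm_def]
      congr 1
      refine eLpNorm_congr_norm_ae ?_
      filter_upwards [hι f, hι n] with x h1 h2
      rw [h1, h2]
      simp [n]
    rw [← e2]
    refine le_trans ?_ (norm_inner_le_norm (𝕜 := ℂ) (ι 1) (ι n))
    rw [← e, Complex.norm_real]
    exact le_abs_self _
  obtain ⟨C, hC⟩ := hbound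
  let A₀ : Submodule ℂ C(K, ℂ) :=
    { carrier := {f | f ∈ A ∧ f z = 0}
      zero_mem' := ⟨A.zero_mem, rfl⟩
      add_mem' := fun {a b} ha hb => ⟨A.add_mem ha.1 hb.1, by simp [ha.2, hb.2]⟩
      smul_mem' := fun c a ha => ⟨A.smul_mem ha.1 c, by simp [ha.2]⟩ }
  let N : Submodule ℂ (Lp ℂ 2 η) := (A₀.map ι.toLinearMap).topologicalClosure
  have : CompleteSpace N := (Submodule.isClosed_topologicalClosure _).completeSpace_coe
  -- If f ∈ A₀ were L^2-close to 1, then 1 - f would have small norm but the value 1 at z.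
  have h1N : ι 1 ∉ N := by
    intro hmem
    have hpos : 0 < 1 / (|C| + 1) := by positivity
    obtain ⟨_, ⟨f, hf, rfl⟩, hlt⟩ := Metric.mem_closure_iff.1 hmem _ hpos
    have h2 := hC (1 - f) (A.sub_mem A.one_mem hf.1)
    have h3 : (1 - f) z = 1 := by simp [hf.2]
    rw [h3, norm_one, map_sub] at h2
    rw [dist_eq_norm, lt_div_iff₀ (by positivity)] at hlt
    have hlt' : ‖ι 1 - ι f‖ * (|C| + 1) < 1 := hlt
    nlinarith [le_abs_self C, norm_nonneg (ι 1 - ι f)]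
  obtain ⟨P, hP, hPo⟩ : ∃ P ∈ N, ∀ w ∈ N, inner ℂ w (ι 1 - P) = 0 := by
    refine ⟨N.starProjection (ι 1), N.starProjection_apply_mem _, fun w hw => ?_⟩
    exact (Submodule.mem_orthogonal N _).1 (N.sub_starProjection_mem_orthogonal (ι 1)) w hw
  let F : Lp ℂ 2 η := ι 1 - P
  have hF0 : F ≠ 0 := fun h0 => h1N (by rw [sub_eq_zero.1 h0]; exact hP)
  have hF2 : Integrable (fun x => ‖F x‖ ^ 2) η := (Lp.memLp F).integrable_norm_pow two_ne_zero
  -- With w the product of F and the conjugate of g, the integral is ⟨w, F⟩. For f ∈ A the product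
  -- gf lies in A₀, so ⟨w, f⟩ = ⟨F, gf⟩ = 0; hence w is orthogonal to the closure of `A`, which
  -- contains F. Thus |F|², normalized, represents z.
  have key : ∀ g ∈ A, g z = 0 → ∫ x, g x * (‖F x‖ ^ 2 : ℝ) ∂η = 0 := by
    intro g hg hgz
    have hmem : MemLp (fun x => (starRingEnd ℂ) (g x) * F x) 2 η := by
      refine (Lp.memLp F).of_le_mul (c := ‖g‖) ?_ (Filter.Eventually.of_forall fun x => ?_)
      · exact (Complex.continuous_conj.comp g.continuous).aestronglyMeasurable.mul
          (Lp.aestronglyMeasurable F)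
      · rw [norm_mul, RCLike.norm_conj]
        gcongr
        exact g.norm_coe_le_norm x
    let w := hmem.toLp
    have hw := hmem.coeFn_toLp
    have hιw : ∀ u : Lp ℂ 2 η, inner ℂ w u = ∫ x, g x * ((starRingEnd ℂ) (F x) * u x) ∂η := by
      intro u
      rw [L2.inner_def]
      refine integral_congr_ae ?_
      filter_upwards [hw] with x hx
      change inner ℂ (w x) (u x) = _
      rw [hx]
      simp only [RCLike.inner_apply, map_mul, Complex.conj_conj]
      ring
    have hort : ∀ f ∈ A, inner ℂ w (ι f) = 0 := by
      intro f hf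
      have hgf : ι (g * f) ∈ N := Submodule.le_topologicalClosure _
        ⟨g * f, ⟨A.mul_mem hg hf, by simp [hgz]⟩, rfl⟩
      have h0 : inner ℂ F (ι (g * f)) = 0 := by
        rw [← inner_conj_symm, hPo _ hgf, map_zero]
      rw [hιw, ← h0, L2.inner_def]
      refine integral_congr_ae ?_
      filter_upwards [hι f, hι (g * f)] with x h1 h2
      rw [h1, h2]
      simp only [RCLike.inner_apply, ContinuousMap.mul_apply]
      ring
    have hclosed : IsClosed {u : Lp ℂ 2 η | inner ℂ w u = 0} :=
      isClosed_eq (by fun_prop) continuous_const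
    have hPw : inner ℂ w P = 0 := by
      refine closure_minimal ?_ hclosed hP
      rintro _ ⟨f, hf, rfl⟩
      exact hort f hf.1
    have hFw : inner ℂ w F = 0 := by
      rw [inner_sub_right, hort 1 A.one_mem, hPw, sub_zero]
    rw [hιw] at hFw
    rw [← hFw]
    refine integral_congr_ae (Filter.Eventually.of_forall fun x => ?_)
    simp only
    rw [mul_comm ((starRingEnd ℂ) (F x)), Complex.mul_conj, Complex.normSq_eq_norm_sq]
  let c : ℝ := ∫ x, ‖F x‖ ^ 2 ∂η
  have hc : 0 < c := by
    have h1 : c = ‖F‖ ^ 2 := by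
      have h2 : ((‖F‖ ^ 2 : ℝ) : ℂ) = inner ℂ F F := by
        rw [inner_self_eq_norm_sq_to_K]; push_cast; rfl
      have h3 : (c : ℂ) = inner ℂ F F := by
        rw [L2.inner_def, ← integral_complex_ofReal]
        refine integral_congr_ae (Filter.Eventually.of_forall fun x => ?_)
        simp only [inner_self_eq_norm_sq_to_K]
        push_cast
        rfl
      exact_mod_cast h3.trans h2.symm
    rw [h1]
    have : 0 < ‖F‖ := norm_pos_iff.2 hF0
    positivity
  let d : K → ℝ≥0∞ := fun x => ENNReal.ofReal (c⁻¹ * ‖F x‖ ^ 2)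
  have hdm : AEMeasurable d η :=
    (hF2.1.aemeasurable.const_mul c⁻¹).ennreal_ofReal
  have hint : ∀ f : C(K, ℂ), ∫ x, f x ∂(η.withDensity d)
      = (c⁻¹ : ℝ) • ∫ x, f x * (‖F x‖ ^ 2 : ℝ) ∂η := by
    intro f
    rw [integral_withDensity_eq_integral_toReal_smul₀ hdm
      (Filter.Eventually.of_forall fun x => ENNReal.ofReal_lt_top), ← integral_smul]
    refine integral_congr_ae (Filter.Eventually.of_forall fun x => ?_)
    simp only [d]
    rw [ENNReal.toReal_ofReal (by positivity), Complex.real_smul, Complex.real_smul]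
    push_cast
    ring
  have hprob : IsProbabilityMeasure (η.withDensity d) := by
    constructor
    rw [withDensity_apply _ MeasurableSet.univ, Measure.restrict_univ,
      ← ofReal_integral_eq_lintegral_ofReal (hF2.const_mul c⁻¹)
        (Filter.Eventually.of_forall fun x => by positivity), integral_const_mul,
      inv_mul_cancel₀ hc.ne', ENNReal.ofReal_one]
  refine ⟨η.withDensity d, ⟨hprob, fun f hf => ?_⟩,
    (withDensity_absolutelyContinuous _ _).trans (withDensity_absolutelyContinuous _ _)⟩
  let g : C(K, ℂ) := f - algebraMap ℂ C(K, ℂ) (f z)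
  have hg : g ∈ A := A.sub_mem hf (A.algebraMap_mem _)
  have hgx : ∀ x, g x = f x - f z := fun x => rfl
  have hg0 : ∫ x, g x ∂(η.withDensity d) = 0 := by
    rw [hint, key g hg (by rw [hgx, sub_self]), smul_zero]
  have : ∫ x, g x ∂(η.withDensity d) = ∫ x, f x ∂(η.withDensity d) - f z := by
    simp only [hgx]
    rw [integral_sub (integrable_continuousMap _ f) (integrable_const _)]
    simp
  rw [hg0] at this
  exact (sub_eq_zero.1 this.symm)

/-- A point off the Choquet boundary is a point mass in the band generated by `A^⊥`. -/
theorem dirac_mem_bandPerp {A : Subalgebra ℂ C(K, ℂ)} {z : K} (hz : z ∉ choquetBoundary A) :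
    (Measure.dirac z).withDensityᵥ (fun _ => (1 : ℂ)) ∈ bandPerp (Subalgebra.toSubmodule A) := by
  simp only [choquetBoundary, Set.mem_ofPred_eq, not_forall] at hz
  obtain ⟨μ, hμ, hne⟩ := hz
  have := hμ.isProbability
  let a : ComplexMeasure K := μ.withDensityᵥ fun _ => (1 : ℂ)
  let b : ComplexMeasure K := (Measure.dirac z).withDensityᵥ fun _ => (1 : ℂ)
  have hab : a - b ∈ annihilator (Subalgebra.toSubmodule A) := by
    rw [mem_annihilator_iff]
    intro f hf
    rw [map_sub, sub_apply, toDual_withDensityᵥ (integrable_const _),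
      toDual_withDensityᵥ (integrable_const _)]
    simp only [mul_one]
    rw [hμ.integral_eq f hf, integral_dirac, sub_self]
  refine mem_bandPerp_of_ac (annihilator_subset_bandPerp _ hab) ?_
  rw [variation_withDensityᵥ_one]
  -- Without an atom of a - b at z the measure μ would have mass 1 at z, that is, μ = δ_z.
  have hpos : (a - b).variation {z} ≠ 0 := by
    intro h0
    have h1 := VectorMeasure.enorm_measure_le_variation (a - b) {z}
    rw [h0] at h1
    have h2 : a {z} = b {z} := by
      have : (a - b) {z} = 0 := by simpa using h1
      rwa [sub_apply, sub_eq_zero] at this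
    have hm : MeasurableSet {z} := measurableSet_singleton z
    rw [withDensityᵥ_apply (integrable_const _) hm, withDensityᵥ_apply (integrable_const _) hm] at h2
    simp only [integral_const, measureReal_restrict_apply_univ] at h2
    have h3 : μ.real {z} = 1 := by
      have := congrArg Complex.re h2
      simpa [measureReal_def] using this
    have h4 : μ {z}ᶜ = 0 := by
      rw [prob_compl_eq_zero_iff hm, ← ENNReal.toReal_eq_one_iff]
      exact h3
    apply hne
    ext s hs
    rw [Measure.dirac_apply' _ hs]
    by_cases hzs : z ∈ s
    · rw [Set.indicator_of_mem hzs, Pi.one_apply, ← prob_compl_eq_zero_iff hs]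
      exact measure_mono_null (by simpa using hzs) h4
    · rw [Set.indicator_of_notMem hzs]
      exact measure_mono_null (by simpa [Set.subset_compl_singleton_iff] using hzs) h4
  refine Measure.AbsolutelyContinuous.mk fun s hs h0 => ?_
  rw [Measure.dirac_apply' _ hs, Set.indicator_apply_eq_zero]
  intro hzs
  exact absurd (measure_mono_null (Set.singleton_subset_iff.2 hzs) h0) hpos

end Representing

/-! ### Pairing `L^∞(B)` with the measures of B. -/

section Pairing

variable {K : Type*} [MeasurableSpace K] {B : Submodule ℂ (ComplexMeasure K)}

theorem integrable_Lp_top_of_ac {ρ ρ' : Measure K} [IsFiniteMeasure ρ'] (h : ρ' ≪ ρ)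
    (G : Lp ℂ ∞ ρ) : Integrable G ρ' :=
  Integrable.of_bound ((Lp.aestronglyMeasurable G).mono_ac h) ‖G‖ (h.ae_le (ae_norm_le_norm G))

theorem cintegral_withDensityᵥ_Lp_top {ρ : Measure K} {k : K → ℂ} (hk : Integrable k ρ)
    (G : Lp ℂ ∞ ρ) : cintegral (ρ.withDensityᵥ k) G = ∫ x, G x * k x ∂ρ :=
  cintegral_withDensityᵥ hk (integrable_Lp_top_of_ac (variation_withDensityᵥ_ac hk) G)

theorem integral_Lp_top_mul_add {ρ : Measure K} (G : Lp ℂ ∞ ρ) {h k : K → ℂ}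
    (hh : Integrable h ρ) (hk : Integrable k ρ) :
    ∫ x, G x * (h + k) x ∂ρ = ∫ x, G x * h x ∂ρ + ∫ x, G x * k x ∂ρ := by
  rw [← integral_add (integrable_Lp_top_mul G hh) (integrable_Lp_top_mul G hk)]
  simp [mul_add]

theorem cintegral_proj_eq (D : LInfBand B) {κ ν : B}
    (h : (κ : ComplexMeasure K).variation ≪ (ν : ComplexMeasure K).variation) :
    cintegral (κ : ComplexMeasure K) (proj B κ D) = cintegral (κ : ComplexMeasure K) (proj B ν D) :=
  VectorMeasure.integral_congr_ae (D.2 κ ν h)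

theorem cintegral_proj_withDensityᵥ (D : LInfBand B) {κ ν : B} {k : K → ℂ}
    (hk : Integrable k (ν : ComplexMeasure K).variation)
    (hκ : (κ : ComplexMeasure K) = (ν : ComplexMeasure K).variation.withDensityᵥ k) :
    cintegral (κ : ComplexMeasure K) (proj B κ D)
      = ∫ x, proj B ν D x * k x ∂(ν : ComplexMeasure K).variation := by
  have hac : (κ : ComplexMeasure K).variation ≪ (ν : ComplexMeasure K).variation :=
    hκ ▸ variation_withDensityᵥ_ac hk
  exact (cintegral_proj_eq D hac).trans ((congrArg (fun μ => cintegral μ (proj B ν D)) hκ).trans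
    (cintegral_withDensityᵥ_Lp_top hk _))

end Pairing

/-! ### Linearity of the pairing, and `L^∞(B)` as the dual of B. -/

section Band

variable {K : Type*} [MetricSpace K] [CompactSpace K] [MeasurableSpace K] [BorelSpace K]
  {B : Submodule ℂ (ComplexMeasure K)}

theorem IsBand.exists_common_density (hB : IsBand B) (a b : B) : ∃ (ν : B) (h k : K → ℂ),
    Integrable h (ν : ComplexMeasure K).variation ∧ Integrable k (ν : ComplexMeasure K).variation ∧
      (a : ComplexMeasure K) = (ν : ComplexMeasure K).variation.withDensityᵥ h ∧
      (b : ComplexMeasure K) = (ν : ComplexMeasure K).variation.withDensityᵥ k := by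
  obtain ⟨m, hm, hmν⟩ := hB.exists_dominating (fun n => if n = 0 then a else b) (fun n => by
    split_ifs
    exacts [a.2, b.2])
  obtain ⟨h, hh, e₁⟩ := exists_density (hmν 0)
  obtain ⟨k, hk, e₂⟩ := exists_density (hmν 1)
  exact ⟨⟨m, hm⟩, h, k, hh, hk, by simpa using e₁, by simpa using e₂⟩

theorem cintegral_proj_add_of_density (D : LInfBand B) {a b c ν : B} {h k : K → ℂ}
    (hh : Integrable h (ν : ComplexMeasure K).variation)
    (hk : Integrable k (ν : ComplexMeasure K).variation)
    (e₁ : (a : ComplexMeasure K) = (ν : ComplexMeasure K).variation.withDensityᵥ h)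
    (e₂ : (b : ComplexMeasure K) = (ν : ComplexMeasure K).variation.withDensityᵥ k)
    (e₃ : (c : ComplexMeasure K) = (a : ComplexMeasure K) + b) :
    cintegral (c : ComplexMeasure K) (proj B c D)
      = cintegral (a : ComplexMeasure K) (proj B a D)
        + cintegral (b : ComplexMeasure K) (proj B b D) := by
  have e₄ : (c : ComplexMeasure K)
      = (ν : ComplexMeasure K).variation.withDensityᵥ (h + k) :=
    (e₃.trans (congrArg₂ (· + ·) e₁ e₂)).trans (withDensityᵥ_add hh hk).symm
  refine (cintegral_proj_withDensityᵥ D (hh.add hk) e₄).trans ?_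
  refine Eq.trans ?_ (congrArg (· + _) (cintegral_proj_withDensityᵥ D hh e₁)).symm
  refine Eq.trans ?_ (congrArg (_ + ·) (cintegral_proj_withDensityᵥ D hk e₂)).symm
  generalize proj B ν D = G
  exact integral_Lp_top_mul_add G hh hk

theorem cintegral_proj_eq_add (hB : IsBand B) (D : LInfBand B) {a b c : B}
    (e : (c : ComplexMeasure K) = (a : ComplexMeasure K) + b) :
    cintegral (c : ComplexMeasure K) (proj B c D)
      = cintegral (a : ComplexMeasure K) (proj B a D)
        + cintegral (b : ComplexMeasure K) (proj B b D) := by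
  exact (hB.exists_common_density a b).elim fun ν H => H.elim fun h H => H.elim fun k H =>
    cintegral_proj_add_of_density D (ν := ν) (h := h) (k := k) H.1 H.2.1 H.2.2.1 H.2.2.2 e

theorem cintegral_proj_smul (hB : IsBand B) (D : LInfBand B) (c : ℂ) (a : B) :
    cintegral ((c • a : B) : ComplexMeasure K) (proj B (c • a) D)
      = c * cintegral (a : ComplexMeasure K) (proj B a D) := by
  obtain ⟨ν, h, -, hh, -, e₁, -⟩ := hB.exists_common_density a a
  have e₃ : ((c • a : B) : ComplexMeasure K)
      = (ν : ComplexMeasure K).variation.withDensityᵥ (c • h) := by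
    rw [withDensityᵥ_smul, ← e₁, Submodule.coe_smul]
  refine (cintegral_proj_withDensityᵥ D (hh.smul c) e₃).trans ?_
  refine Eq.trans ?_ (congrArg (c * ·) (cintegral_proj_withDensityᵥ D hh e₁)).symm
  generalize proj B ν D = G
  refine Eq.trans ?_ (integral_const_mul c _)
  simp [mul_left_comm]

/-- The pairing `⟨ν, D⟩ = ∫ D_ν dν` as a linear functional of `ν`. -/
noncomputable def pairing (hB : IsBand B) (D : LInfBand B) : B →ₗ[ℂ] ℂ where
  toFun ν := cintegral (ν : ComplexMeasure K) (proj B ν D)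
  map_add' a b := cintegral_proj_eq_add hB D (Submodule.coe_add a b)
  map_smul' := cintegral_proj_smul hB D

theorem cintegral_toLInf (ν : ComplexMeasure K) (f : C(K, ℂ)) :
    cintegral ν (toLInf ν f) = cintegral ν f :=
  VectorMeasure.integral_congr_ae (memLp_top ν.variation f).coeFn_toLp

theorem Lp_top_eq_of_forall_integral {ρ : Measure K} [IsFiniteMeasure ρ] {F G : K → ℂ}
    (hF : Integrable F ρ) (hG : Integrable G ρ)
    (h : ∀ s, MeasurableSet s → ∫ x, F x * s.indicator 1 x ∂ρ = ∫ x, G x * s.indicator 1 x ∂ρ) :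
    F =ᵐ[ρ] G := by
  refine Integrable.ae_eq_of_forall_setIntegral_eq F G hF hG fun s hs _ => ?_
  have e : ∀ H : K → ℂ, ∫ x, H x * s.indicator 1 x ∂ρ = ∫ x in s, H x ∂ρ := fun H => by
    rw [← integral_indicator hs]
    refine integral_congr_ae (Filter.Eventually.of_forall fun x => ?_)
    by_cases hx : x ∈ s <;> simp [hx]
  rw [← e, ← e, h s hs]

/-- Every bounded functional on a band `B` is given by an element of `L^∞(B)`. -/
theorem exists_LInfBand_repr (hB : IsBand B) (Φ : B →ₗ[ℂ] ℂ) {C : ℝ} (hC : 0 ≤ C)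
    (hΦ : ∀ ν : B, ‖Φ ν‖ ≤ C * ‖toDual (ν : ComplexMeasure K)‖) :
    ∃ D : LInfBand B, ∀ (ν κ : B) (k : K → ℂ), Integrable k (ν : ComplexMeasure K).variation →
      (κ : ComplexMeasure K) = (ν : ComplexMeasure K).variation.withDensityᵥ k →
      Φ κ = ∫ x, proj B ν D x * k x ∂(ν : ComplexMeasure K).variation := by
  have hmem : ∀ (ν : B) {k : K → ℂ}, Integrable k (ν : ComplexMeasure K).variation →
      (ν : ComplexMeasure K).variation.withDensityᵥ k ∈ B := fun ν k hk =>
    hB.mem_of_ac ν ν.2 _ (variation_withDensityᵥ_ac hk)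
  have hrep : ∀ ν : B, ∃ G : Lp ℂ ∞ (ν : ComplexMeasure K).variation, ‖G‖ ≤ C ∧
      ∀ (k : K → ℂ) (hk : Integrable k (ν : ComplexMeasure K).variation),
        Φ ⟨_, hmem ν hk⟩ = ∫ x, G x * k x ∂(ν : ComplexMeasure K).variation := fun ν => by
    let Ψ : Lp ℂ 1 (ν : ComplexMeasure K).variation →L[ℂ] ℂ := LinearMap.mkContinuous
      { toFun := fun k => Φ ⟨_, hmem ν (L1.integrable_coeFn k)⟩
        map_add' := fun f g => by
          rw [← map_add]
          congr 1
          refine Subtype.ext ?_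
          change _ = (ν : ComplexMeasure K).variation.withDensityᵥ f
            + (ν : ComplexMeasure K).variation.withDensityᵥ g
          rw [← withDensityᵥ_add (L1.integrable_coeFn f) (L1.integrable_coeFn g)]
          exact WithDensityᵥEq.congr_ae (Lp.coeFn_add f g)
        map_smul' := fun c f => by
          rw [RingHom.id_apply, ← map_smul]
          congr 1
          refine Subtype.ext ?_
          change _ = c • (ν : ComplexMeasure K).variation.withDensityᵥ f
          rw [← withDensityᵥ_smul]
          exact WithDensityᵥEq.congr_ae (Lp.coeFn_smul c f) } C
      (fun k => by
        refine (hΦ _).trans_eq ?_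
        rw [L1.norm_eq_integral_norm]
        congr 1
        exact norm_toDual_withDensityᵥ (L1.integrable_coeFn k))
    obtain ⟨G, hG, hGk⟩ := exists_Lp_top_repr Ψ
    refine ⟨G, hG.trans (LinearMap.mkContinuous_norm_le _ hC _), fun k hk => ?_⟩
    have h1 := hGk (hk.toL1 k)
    have h2 : Ψ (hk.toL1 k) = Φ ⟨_, hmem ν hk⟩ := by
      change Φ _ = Φ _
      congr 1
      exact Subtype.ext (WithDensityᵥEq.congr_ae hk.coeFn_toL1)
    rw [← h2, h1]
    refine integral_congr_ae ?_
    filter_upwards [hk.coeFn_toL1] with x hx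
    rw [hx]
  choose G hGn hG using hrep
  have hind : ∀ (ρ : Measure K) [IsFiniteMeasure ρ] {s : Set K}, MeasurableSet s →
      Integrable (s.indicator (1 : K → ℂ)) ρ := fun ρ _ s hs =>
    (integrable_const (1 : ℂ)).indicator hs
  refine ⟨⟨⟨G, memℓp_infty ⟨C, by rintro _ ⟨ν, rfl⟩; exact hGn ν⟩⟩, fun ν μ hac => ?_⟩,
    fun ν κ k hk hκ => ?_⟩
  · refine Lp_top_eq_of_forall_integral (integrable_Lp_top_of_ac Measure.AbsolutelyContinuous.rfl _)
      (integrable_Lp_top_of_ac hac _) fun s hs => ?_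
    have hs' := hind (ν : ComplexMeasure K).variation hs
    -- The measure 1_s|ν| is also k|μ|, and its value under Φ is computed by G ν and by G μ; this
    -- gives the compatibility of the family.
    obtain ⟨k, hk, hkν⟩ := exists_density ((variation_withDensityᵥ_ac hs').trans hac)
    change ∫ x, G ν x * _ ∂_ = ∫ x, G μ x * _ ∂_
    have e1 : Φ ⟨_, hmem ν hs'⟩ = Φ ⟨_, hmem μ hk⟩ := by
      congr 1
      exact Subtype.ext hkν
    rw [← hG ν _ hs', e1, hG μ k hk, ← cintegral_withDensityᵥ_Lp_top hk, ← hkν]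
    exact cintegral_withDensityᵥ hs' (integrable_Lp_top_of_ac
      ((variation_withDensityᵥ_ac hs').trans hac) _)
  · change Φ κ = ∫ x, G ν x * k x ∂_
    rw [← hG ν k hk]
    congr 1
    exact Subtype.ext hκ

end Band

/-! ### The lifting property implies both conclusions. -/

section StrongDavie

variable {K : Type*} [MetricSpace K] [CompactSpace K] [MeasurableSpace K] [BorelSpace K]
  {X : Submodule ℂ C(K, ℂ)}

/-- `m` lifts `B` modulo `X^⊥`: the cosets of `X^⊥` contain measures absolutely continuous
with respect to `m`, of almost minimal norm. -/
def LiftsBand (X : Submodule ℂ C(K, ℂ)) (B : Submodule ℂ (ComplexMeasure K))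
    (m : ComplexMeasure K) : Prop :=
  ∀ C : ℝ, 1 < C → ∀ ν ∈ B, ∃ h : K → ℂ, Integrable h m.variation ∧
    ν - m.variation.withDensityᵥ h ∈ annihilator X ∧
    ∫ x, ‖h x‖ ∂m.variation ≤ C * ‖toDual ν‖

variable {B : Submodule ℂ (ComplexMeasure K)}

/-- Pairing with a fixed measure is weak-star continuous and vanishes on X. -/
theorem pairing_eq_zero_of_mem_HInfBand (hB : IsBand B) {F : LInfBand B}
    (hF : F ∈ HInfBand X B) {ν : B} (hν : (ν : ComplexMeasure K) ∈ annihilator X) :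
    pairing hB F ν = 0 := by
  refine apply_eq_zero_of_mem_closure_induced
    (p := fun (F : LInfBand B) (ν : B) => pairing hB F ν) (y := F)
    (s := toLInfBand B '' (X : Set C(K, ℂ))) hF (i := ν) ?_
  rintro _ ⟨f, hf, rfl⟩
  exact (cintegral_toLInf (ν : ComplexMeasure K) f).trans (hν f hf)

theorem integral_toLInf_mul {m : ComplexMeasure K} {h : K → ℂ}
    (hh : Integrable h m.variation) (f : C(K, ℂ)) :
    ∫ x, toLInf m f x * h x ∂m.variation = toDual (m.variation.withDensityᵥ h) f := by
  rw [toDual_withDensityᵥ hh]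
  refine integral_congr_ae ?_
  filter_upwards [(memLp_top m.variation f).coeFn_toLp] with x hx
  exact congrArg (· * h x) hx

theorem integral_eq_zero_of_mem_HInf {m : ComplexMeasure K} {F : Lp ℂ ∞ m.variation}
    (hF : F ∈ HInf X m) {h : K → ℂ} (hh : Integrable h m.variation)
    (hν : m.variation.withDensityᵥ h ∈ annihilator X) : ∫ x, F x * h x ∂m.variation = 0 := by
  have e : ∀ G : Lp ℂ ∞ m.variation,
      ∫ x, G x * hh.toL1 h x ∂m.variation = ∫ x, G x * h x ∂m.variation := fun G => by
    refine integral_congr_ae ?_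
    filter_upwards [hh.coeFn_toL1] with x hx
    rw [hx]
  rw [← e]
  refine apply_eq_zero_of_mem_closure_induced (i := hh.toL1 h) hF ?_
  rintro _ ⟨f, hf, rfl⟩
  exact (e _).trans ((integral_toLInf_mul hh f).trans (hν f hf))

/-- D does not see the difference between κ and its lift h|m|, and the pairing with h|m| involves
D_m only. -/
theorem norm_pairing_le_mul (hB : IsBand B) {m : B} (hm : LiftsBand X B m) {D : LInfBand B}
    (hD : ∀ ν : B, (ν : ComplexMeasure K) ∈ annihilator X → pairing hB D ν = 0) (κ : B) {C : ℝ}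
    (hC : 1 < C) :
    ‖pairing hB D κ‖ ≤ C * (‖proj B m D‖ * ‖toDual (κ : ComplexMeasure K)‖) :=
  (hm C hC κ κ.2).elim fun h ⟨hh, hν, hle⟩ => by
    let μ : B := ⟨_, hB.mem_of_ac m m.2 _ (variation_withDensityᵥ_ac hh)⟩
    have h1 : pairing hB D κ = pairing hB D μ := by
      rw [← sub_eq_zero, ← map_sub]
      exact hD _ hν
    have h2 : pairing hB D μ = ∫ x, proj B m D x * h x ∂(m : ComplexMeasure K).variation :=
      cintegral_proj_withDensityᵥ D (κ := μ) hh rfl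
    rw [h1, h2]
    refine (norm_integral_Lp_top_mul_le _ hh).trans ?_
    calc _ ≤ ‖proj B m D‖ * (C * ‖toDual (κ : ComplexMeasure K)‖) := by gcongr
      _ = _ := by ring

theorem norm_pairing_le (hB : IsBand B) {m : B} (hm : LiftsBand X B m) {D : LInfBand B}
    (hD : ∀ ν : B, (ν : ComplexMeasure K) ∈ annihilator X → pairing hB D ν = 0) (κ : B) :
    ‖pairing hB D κ‖ ≤ ‖proj B m D‖ * ‖toDual (κ : ComplexMeasure K)‖ := by
  have ht : Filter.Tendsto (fun C : ℝ => C * (‖proj B m D‖ * ‖toDual (κ : ComplexMeasure K)‖))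
      (nhdsWithin 1 (Set.Ioi 1)) (nhds (1 * (‖proj B m D‖ * ‖toDual (κ : ComplexMeasure K)‖))) :=
    (Filter.tendsto_id.mul_const _).mono_left nhdsWithin_le_nhds
  rw [one_mul] at ht
  refine ge_of_tendsto ht ?_
  filter_upwards [self_mem_nhdsWithin] with C hC
  exact norm_pairing_le_mul hB hm hD κ hC

theorem norm_Lp_top_le_of_forall_integral {ρ : Measure K} [IsFiniteMeasure ρ] (G : Lp ℂ ∞ ρ) {C : ℝ}
    (hC : 0 ≤ C) (H : ∀ k : K → ℂ, Integrable k ρ → ‖∫ x, G x * k x ∂ρ‖ ≤ C * ∫ x, ‖k x‖ ∂ρ) :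
    ‖G‖ ≤ C := by
  refine norm_Lp_top_le hC (ae_norm_le_of_setIntegral_le
    (integrable_Lp_top_of_ac Measure.AbsolutelyContinuous.rfl G) hC fun s hs => ?_)
  have h := H (s.indicator 1) ((integrable_const (1 : ℂ)).indicator hs)
  have e1 : ∫ x, G x * s.indicator 1 x ∂ρ = ∫ x in s, G x ∂ρ := by
    rw [← integral_indicator hs]
    refine integral_congr_ae (Filter.Eventually.of_forall fun x => ?_)
    by_cases hx : x ∈ s <;> simp [hx]
  have e2 : ∫ x, ‖s.indicator (1 : K → ℂ) x‖ ∂ρ = ρ.real s := by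
    rw [← integral_indicator_one hs]
    refine integral_congr_ae (Filter.Eventually.of_forall fun x => ?_)
    by_cases hx : x ∈ s <;> simp [hx]
  rwa [e1, e2] at h

/-- The norm of D_ν is tested on measures k|ν|, which lie in B, and there the pairing is bounded
through D_m by `norm_pairing_le`. -/
theorem norm_proj_eq (hB : IsBand B) {m : B} (hm : LiftsBand X B m) {D : LInfBand B}
    (hD : ∀ ν : B, (ν : ComplexMeasure K) ∈ annihilator X → pairing hB D ν = 0) :
    ‖proj B m D‖ = ‖D‖ := by
  refine le_antisymm (lp.norm_apply_le_norm ENNReal.top_ne_zero D.1 m) ?_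
  refine lp.norm_le_of_forall_le (norm_nonneg _) fun ν => ?_
  refine norm_Lp_top_le_of_forall_integral (proj B ν D) (norm_nonneg _) fun k hk => ?_
  let μ : B := ⟨_, hB.mem_of_ac ν ν.2 _ (variation_withDensityᵥ_ac hk)⟩
  have h2 : pairing hB D μ = ∫ x, proj B ν D x * k x ∂(ν : ComplexMeasure K).variation :=
    cintegral_proj_withDensityᵥ D (κ := μ) hk rfl
  rw [← h2, ← norm_toDual_withDensityᵥ hk]
  exact norm_pairing_le hB hm hD μ

theorem integral_Lp_top_sub_mul {ρ : Measure K} (F G : Lp ℂ ∞ ρ) {k : K → ℂ}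
    (hk : Integrable k ρ) :
    ∫ x, (F - G) x * k x ∂ρ = ∫ x, F x * k x ∂ρ - ∫ x, G x * k x ∂ρ := by
  rw [← integral_sub (integrable_Lp_top_mul F hk) (integrable_Lp_top_mul G hk)]
  refine integral_congr_ae ?_
  filter_upwards [Lp.coeFn_sub F G] with x hx
  rw [hx, Pi.sub_apply, sub_mul]

theorem pairing_sub (hB : IsBand B) (F G : LInfBand B) (ν : B) :
    pairing hB (F - G) ν = pairing hB F ν - pairing hB G ν := by
  obtain ⟨h, hh, hν⟩ := exists_density_self (ν : ComplexMeasure K)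
  have e : ∀ H : LInfBand B, pairing hB H ν
      = ∫ x, proj B ν H x * h x ∂(ν : ComplexMeasure K).variation := fun H =>
    cintegral_proj_withDensityᵥ H hh hν
  exact (e (F - G)).trans ((integral_Lp_top_sub_mul (proj B ν F) (proj B ν G) hh).trans
    (congrArg₂ (· - ·) (e F) (e G)).symm)

theorem dist_proj_eq (hB : IsBand B) {m : B} (hm : LiftsBand X B m) {F G : LInfBand B}
    (hF : F ∈ HInfBand X B) (hG : G ∈ HInfBand X B) :
    dist (proj B m F) (proj B m G) = dist F G := by
  refine ((dist_eq_norm _ _).trans ?_).trans (dist_eq_norm F G).symm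
  refine (congrArg norm (map_sub (proj B m) F G).symm).trans ?_
  refine norm_proj_eq hB hm fun ν hν => ?_
  rw [pairing_sub, pairing_eq_zero_of_mem_HInfBand hB hF hν,
    pairing_eq_zero_of_mem_HInfBand hB hG hν, sub_zero]

/-- The projection is weak-star continuous: integrating F_m against g ∈ L^1(|m|) is pairing F with
the measure g|m| of B. -/
theorem proj_mem_HInf (hB : IsBand B) (m : B) {F : LInfBand B} (hF : F ∈ HInfBand X B) :
    proj B m F ∈ HInf X (m : ComplexMeasure K) := by
  refine mem_closure_induced_of_reindex
    (p := fun (F : LInfBand B) (ν : B) => cintegral (ν : ComplexMeasure K) (proj B ν F))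
    (p' := fun (F : Lp ℂ ∞ (m : ComplexMeasure K).variation)
      (g : Lp ℂ 1 (m : ComplexMeasure K).variation) =>
        ∫ x, F x * g x ∂(m : ComplexMeasure K).variation)
    (s := toLInfBand B '' (X : Set C(K, ℂ))) (y := F)
    (fun g => ⟨_, hB.mem_of_ac m m.2 _ (variation_withDensityᵥ_ac (L1.integrable_coeFn g))⟩)
    (fun D g => ?_) ?_ hF
  · exact (cintegral_proj_withDensityᵥ D (ν := m) (L1.integrable_coeFn g) rfl).symm
  · rintro _ ⟨f, hf, rfl⟩
    exact ⟨f, hf, rfl⟩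

/-- Two lifts of one coset differ by an annihilating measure h|m| - k|m|, which F kills. This makes
the functional induced by F on B independent of choices, hence linear. -/
theorem integral_mul_eq_of_mem_HInf {m : ComplexMeasure K} {F : Lp ℂ ∞ m.variation}
    (hF : F ∈ HInf X m) {ν : ComplexMeasure K} {h k : K → ℂ} (hh : Integrable h m.variation)
    (hk : Integrable k m.variation)
    (hν : toDual ν - toDual (m.variation.withDensityᵥ h) ∈ perp X)
    (hν' : toDual ν - toDual (m.variation.withDensityᵥ k) ∈ perp X) :
    ∫ x, F x * h x ∂m.variation = ∫ x, F x * k x ∂m.variation := by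
  have hz := integral_eq_zero_of_mem_HInf hF (hh.sub hk) (by
    rw [withDensityᵥ_sub hh hk, mem_annihilator_iff, map_sub]
    simpa using sub_mem hν' hν)
  rw [← sub_eq_zero, ← hz, ← integral_sub (integrable_Lp_top_mul F hh) (integrable_Lp_top_mul F hk)]
  simp only [Pi.sub_apply, mul_sub]

/-- The functional on `B` given by integrating `F` against a density of the coset of `ν`. -/
theorem exists_linearMap_of_mem_HInf {m : B} (hm : LiftsBand X B m)
    {F : Lp ℂ ∞ (m : ComplexMeasure K).variation} (hF : F ∈ HInf X (m : ComplexMeasure K)) :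
    ∃ Φ : B →ₗ[ℂ] ℂ, (∀ ν : B, ‖Φ ν‖ ≤ ‖F‖ * 2 * ‖toDual (ν : ComplexMeasure K)‖) ∧
      ∀ (ν : B) (h : K → ℂ), Integrable h (m : ComplexMeasure K).variation →
        toDual (ν : ComplexMeasure K) - toDual ((m : ComplexMeasure K).variation.withDensityᵥ h)
          ∈ perp X →
        Φ ν = ∫ x, F x * h x ∂(m : ComplexMeasure K).variation := by
  -- Any constant above 1 would do: only boundedness of the functional is needed here, the sharp
  -- norm being recovered by `norm_proj_eq`.
  choose h hh hν hle using fun ν : B => hm 2 one_lt_two ν ν.2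
  replace hν : ∀ ν : B, toDual (ν : ComplexMeasure K)
      - toDual ((m : ComplexMeasure K).variation.withDensityᵥ (h ν)) ∈ perp X := fun ν => by
    rw [← map_sub]
    exact mem_annihilator_iff.1 (hν ν)
  refine ⟨{ toFun := fun ν => ∫ x, F x * h ν x ∂(m : ComplexMeasure K).variation
            map_add' := fun a b => ?_
            map_smul' := fun c a => ?_ }, fun ν => ?_, fun ν k hk hkν => ?_⟩
  · have e := integral_mul_eq_of_mem_HInf hF (hh (a + b)) ((hh a).add (hh b)) (hν (a + b)) (by
      rw [withDensityᵥ_add (hh a) (hh b), Submodule.coe_add, map_add, map_add,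
        add_sub_add_comm]
      exact add_mem (hν a) (hν b))
    exact e.trans (integral_Lp_top_mul_add F (hh a) (hh b))
  · have e := integral_mul_eq_of_mem_HInf hF (hh (c • a)) ((hh a).smul c) (hν (c • a)) (by
      rw [withDensityᵥ_smul, Submodule.coe_smul, map_smul, map_smul]
      exact smul_sub c (toDual (a : ComplexMeasure K)) _ ▸ Submodule.smul_mem _ c (hν a))
    refine e.trans (Eq.trans ?_ (integral_const_mul c _))
    simp [mul_left_comm]
  · refine (norm_integral_Lp_top_mul_le F (hh ν)).trans ?_
    rw [mul_assoc]
    exact mul_le_mul_of_nonneg_left (hle ν) (norm_nonneg _)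
  · exact integral_mul_eq_of_mem_HInf hF (hh ν) hk (hν ν) hkν

theorem pairing_eq_of_repr (hB : IsBand B) {D : LInfBand B} {Φ : B →ₗ[ℂ] ℂ}
    (hD : ∀ (ν κ : B) (k : K → ℂ), Integrable k (ν : ComplexMeasure K).variation →
      (κ : ComplexMeasure K) = (ν : ComplexMeasure K).variation.withDensityᵥ k →
      Φ κ = ∫ x, proj B ν D x * k x ∂(ν : ComplexMeasure K).variation) (ν : B) :
    pairing hB D ν = Φ ν :=
  (exists_density_self (ν : ComplexMeasure K)).elim fun h ⟨hh, hν⟩ =>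
    (cintegral_proj_withDensityᵥ D hh hν).trans (hD ν ν h hh hν).symm

theorem pairing_toLInfBand (hB : IsBand B) (f : C(K, ℂ)) (ν : B) :
    pairing hB (toLInfBand B f) ν = toDual (ν : ComplexMeasure K) f :=
  cintegral_toLInf (ν : ComplexMeasure K) f

/-- Bipolar theorem: a finite combination of pairings is the pairing with one measure of B, so
testing on annihilating measures of B suffices. -/
theorem mem_HInfBand_of_annihilates (hB : IsBand B) {D : LInfBand B}
    (hD : ∀ ν : B, (ν : ComplexMeasure K) ∈ annihilator X → pairing hB D ν = 0) :
    D ∈ HInfBand X B := by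
  refine mem_closure_induced_of_annihilates
    (p := fun (F : LInfBand B) (ν : B) => pairing hB F ν) (j := toLInfBand B) (y := D)
    X (fun ν : B => (toDual (ν : ComplexMeasure K)).toLinearMap) (pairing_toLInfBand hB)
    fun s c hs => ?_
  have e : pairing hB D (∑ i ∈ s, c i • i) = ∑ i ∈ s, c i * pairing hB D i := by
    rw [map_sum]
    exact Finset.sum_congr rfl fun i _ => by rw [map_smul, smul_eq_mul]
  refine e.symm.trans (hD _ ?_)
  rw [mem_annihilator_iff, mem_perp]
  intro f hf
  have := hs f hf
  simpa using this

/-- The functional on B induced by F is represented by some D in L^∞(B). It vanishes on annihilating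
measures, since 0 is a lift of them, so D is in H^∞(B); and D_m = F because each k|m| is its own
lift. -/
theorem surjOn_proj (hB : IsBand B) {m : B} (hm : LiftsBand X B m) :
    Set.SurjOn (proj B m) (HInfBand X B) (HInf X (m : ComplexMeasure K)) := fun F hF => by
  obtain ⟨Φ, hΦ, hΦF⟩ := exists_linearMap_of_mem_HInf hm hF
  obtain ⟨D, hD⟩ := exists_LInfBand_repr hB Φ (by positivity) hΦ
  refine ⟨D, mem_HInfBand_of_annihilates hB fun ν hν => ?_, ?_⟩
  · rw [pairing_eq_of_repr hB hD, hΦF ν 0 (integrable_zero _ _ _)]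
    · simp
    · rwa [withDensityᵥ_zero, map_zero, sub_zero]
  · refine Lp.ext (Lp_top_eq_of_forall_integral
      (integrable_Lp_top_of_ac Measure.AbsolutelyContinuous.rfl _)
      (integrable_Lp_top_of_ac Measure.AbsolutelyContinuous.rfl _) fun s hs => ?_)
    have hk : Integrable (s.indicator (1 : K → ℂ)) (m : ComplexMeasure K).variation :=
      (integrable_const (1 : ℂ)).indicator hs
    let κ : B := ⟨_, hB.mem_of_ac m m.2 _ (variation_withDensityᵥ_ac hk)⟩
    refine (hD m κ _ hk rfl).symm.trans (hΦF κ _ hk ?_)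
    rw [sub_self]
    exact zero_mem _

theorem isStrongDavieMeasure_of_liftsBand {A : Subalgebra ℂ C(K, ℂ)}
    {m : bandPerp (Subalgebra.toSubmodule A)} 
    (hm : LiftsBand (Subalgebra.toSubmodule A) (bandPerp (Subalgebra.toSubmodule A)) m) :
    IsStrongDavieMeasure A m where
  bijOn := ⟨fun _ hF => proj_mem_HInf (isBand_bandGenerated _) m hF, fun F hF G hG e => by
    exact eq_of_dist_eq_zero ((dist_proj_eq (isBand_bandGenerated _) hm hF hG).symm.trans
      (dist_eq_zero.2 e)),
    surjOn_proj (isBand_bandGenerated _) hm⟩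
  isometry _ hF _ hG := dist_proj_eq (isBand_bandGenerated _) hm hF hG

/-- The lift h|m| of δ_z agrees with δ_z on `A`, so it is a complex representing measure for z. -/
theorem exists_isRepresenting_of_liftsBand {A : Subalgebra ℂ C(K, ℂ)} {m : ComplexMeasure K}
    (hm : LiftsBand (Subalgebra.toSubmodule A) (bandPerp (Subalgebra.toSubmodule A)) m) {z : K}
    (hz : z ∉ choquetBoundary A) :
    ∃ μ : Measure K, IsRepresenting A z μ ∧ μ ≪ m.variation :=
  (hm 2 one_lt_two _ (dirac_mem_bandPerp hz)).elim fun h ⟨hh, hν, _⟩ => by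
    refine exists_isRepresenting_of_density A z hh fun f hf => ?_
    have e := mem_perp.1 (mem_annihilator_iff.1 hν) f hf
    rw [map_sub, sub_apply, sub_eq_zero, toDual_withDensityᵥ hh,
      toDual_withDensityᵥ (integrable_const _), integral_dirac, mul_one] at e
    exact e.symm

end StrongDavie

end TightAlgebra

theorem theorem3p18 {K : Type*} [MetricSpace K] [CompactSpace K] [MeasurableSpace K] [BorelSpace K]
    (A : Subalgebra ℂ C(K, ℂ)) (hA : TightAlgebra.IsUniformAlgebra A)
    (htight : TightAlgebra.IsTight (Subalgebra.toSubmodule A)) :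
    ∃ m : TightAlgebra.bandPerp (Subalgebra.toSubmodule A),
      TightAlgebra.IsStrongDavieMeasure A m ∧
      ∀ z : K, z ∉ TightAlgebra.choquetBoundary A →
        ∃ μ : MeasureTheory.Measure K, TightAlgebra.IsRepresenting A z μ ∧
          μ ≪ (m : MeasureTheory.ComplexMeasure K).variation := by
  obtain ⟨m, hm, hl⟩ := TightAlgebra.exists_measure_lifting htight
  exact ⟨⟨m, hm⟩, TightAlgebra.isStrongDavieMeasure_of_liftsBand hl,
    fun z hz => TightAlgebra.exists_isRepresenting_of_liftsBand hl hz⟩
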